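/- For a linear order $\mathbb D$, call its elements points and the ordered pairs $I=[a,b]$ with $a<b$ intervals. Consider the following relations (where $I=[a,b]$, $J=[c,d]$ are intervals and $e$ is a point). Point-point: $=_p$ (equality of points) and $<$. Interval-point, $\mathfrak M^+=\{\mathrm{ip}_0,\dots,\mathrm{ip}_4\}$: $I\,\mathrm{ip}_0\,e\iff e<a$; $I\,\mathrm{ip}_1\,e\iff e=a$; $I\,\mathrm{ip}_2\,e\iff a<e<b$; $I\,\mathrm{ip}_3\,e\iff e=b$; $I\,\mathrm{ip}_4\,e\iff b<e$. Interval-interval, $\mathfrak I^+=\{=_i,\mathrm{ii}_{34},\mathrm{ii}_{14},\mathrm{ii}_{03},\mathrm{ii}_{24},\mathrm{ii}_{04},\mathrm{ii}_{44}\}$: $=_i$ is equality of intervals; $I\,\mathrm{ii}_{34}\,J\iff b=c$; $I\,\mathrm{ii}_{14}\,J\iff a=c,\ b<d$; $I\,\mathrm{ii}_{03}\,J\iff c<a,\ b=d$; $I\,\mathrm{ii}_{24}\,J\iff a<c<b<d$; $I\,\mathrm{ii}_{04}\,J\iff c<a,\ b<d$; $I\,\mathrm{ii}_{44}\,J\iff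 b<c$. Let $\mathfrak R^+=\{=_p,<\}\cup\mathfrak M^+\cup\mathfrak I^+$ (14 relations). For $S\subseteq\mathfrak R^+$ let $FO+S$ be two-sorted first-order logic (sorts: points and intervals) without built-in equality, whose relation symbols are those of $S$. For a class $\mathrm C$ of linear orders, $FO+S$ defines $r$ over $\mathrm C$ if there is one $FO+S$-formula $\varphi(x,y)$, with only the free variables $x,y$ of the sorts of $r$, such that $\varphi(x,y)\leftrightarrow r(x,y)$ is valid in the point-interval structure of every $\mathbb D\in\mathrm C$. For $T\in\{\mathfrak R^+,\mathfrak I^+,\mathfrak M^+\}$, a set $S\subseteq T$ is $T$-complete over $\mathrm C$ if $FO+S$ defines every $r\in T$ over $\mathrm C$, and $T$-incomplete otherwise. It is minimally $T$-complete if it is $T$-complete and every proper subset is $T$-incomplete; it is maximally $T$-incomplete if it is $T$-incomplete and every $S'$ with $S\subsetneq S'\subseteq T$ is $T$-complete. Theorem. Let $\mathrm C$ be either the class of all linear orders or the class of all weakly discrete linear orders (every point other than a least one has a direct predecessor and every point other than a greatest one has a direct successor). Then over $\mathrm C$: 1. The minimally $\mathfrak R^+$-complete sets are exactly the following 31 sets: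 $\{\mathrm{ip}_0,\mathrm{ip}_2,<\}$, $\{\mathrm{ip}_0,\mathrm{ip}_3\}$, $\{\mathrm{ip}_0,\mathrm{ip}_4,<\}$, $\{\mathrm{ip}_0,\mathrm{ii}_{14},\mathrm{ii}_{24},<\}$, $\{\mathrm{ip}_0,\mathrm{ii}_{14},\mathrm{ii}_{04},<\}$, $\{\mathrm{ip}_0,\mathrm{ii}_{14},\mathrm{ii}_{44},<\}$, $\{\mathrm{ip}_0,\mathrm{ii}_{03},<\}$, $\{\mathrm{ip}_0,\mathrm{ii}_{34},<\}$, $\{\mathrm{ip}_1,\mathrm{ip}_2\}$, $\{\mathrm{ip}_1,\mathrm{ip}_3\}$, $\{\mathrm{ip}_1,\mathrm{ip}_4\}$, $\{\mathrm{ip}_1,\mathrm{ii}_{14},\mathrm{ii}_{24}\}$, $\{\mathrm{ip}_1,\mathrm{ii}_{14},\mathrm{ii}_{04}\}$, $\{\mathrm{ip}_1,\mathrm{ii}_{14},\mathrm{ii}_{44}\}$, $\{\mathrm{ip}_1,\mathrm{ii}_{03}\}$, $\{\mathrm{ip}_1,\mathrm{ii}_{34}\}$, $\{\mathrm{ip}_2,\mathrm{ip}_3\}$,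 $\{\mathrm{ip}_2,\mathrm{ip}_4,<\}$, $\{\mathrm{ip}_2,\mathrm{ii}_{14},<\}$, $\{\mathrm{ip}_2,\mathrm{ii}_{03},<\}$, $\{\mathrm{ip}_2,\mathrm{ii}_{34},<\}$, $\{\mathrm{ip}_3,\mathrm{ii}_{14}\}$, $\{\mathrm{ip}_3,\mathrm{ii}_{24},\mathrm{ii}_{03}\}$, $\{\mathrm{ip}_3,\mathrm{ii}_{03},\mathrm{ii}_{04}\}$, $\{\mathrm{ip}_3,\mathrm{ii}_{03},\mathrm{ii}_{44}\}$, $\{\mathrm{ip}_3,\mathrm{ii}_{34}\}$, $\{\mathrm{ip}_4,\mathrm{ii}_{14},<\}$, $\{\mathrm{ip}_4,\mathrm{ii}_{24},\mathrm{ii}_{03},<\}$, $\{\mathrm{ip}_4,\mathrm{ii}_{03},\mathrm{ii}_{04},<\}$, $\{\mathrm{ip}_4,\mathrm{ii}_{03},\mathrm{ii}_{44},<\}$, $\{\mathrm{ip}_4,\mathrm{ii}_{34},<\}$. The maximally $\mathfrak R^+$-incomplete sets are exactly $\{=_i,=_p,<,\mathrm{ip}_0,\mathrm{ip}_1,\mathrm{ii}_{14}\}$,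 $\{=_i,=_p,<,\mathrm{ip}_0,\mathrm{ip}_1,\mathrm{ii}_{24},\mathrm{ii}_{04},\mathrm{ii}_{44}\}$, $\{=_p,\mathrm{ip}_0,\mathrm{ip}_2,\mathrm{ip}_4\}\cup\mathfrak I^+$, $\{=_i,=_p,<,\mathrm{ip}_2,\mathrm{ii}_{24},\mathrm{ii}_{04},\mathrm{ii}_{44}\}$, $\{=_p,<\}\cup\mathfrak I^+$, $\{=_i,=_p,<,\mathrm{ip}_3,\mathrm{ip}_4,\mathrm{ii}_{03}\}$, $\{=_i,=_p,<,\mathrm{ip}_3,\mathrm{ip}_4,\mathrm{ii}_{24},\mathrm{ii}_{04},\mathrm{ii}_{44}\}$. 2. The minimally $\mathfrak I^+$-complete subsets of $\mathfrak I^+$ are exactly $\{\mathrm{ii}_{34}\}$, $\{\mathrm{ii}_{14},\mathrm{ii}_{24}\}$, $\{\mathrm{ii}_{14},\mathrm{ii}_{04}\}$, $\{\mathrm{ii}_{14},\mathrm{ii}_{03}\}$, $\{\mathrm{ii}_{14},\mathrm{ii}_{44}\}$, $\{\mathrm{ii}_{03},\mathrm{ii}_{24}\}$, $\{\mathrm{ii}_{03},\mathrm{ii}_{04}\}$,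 $\{\mathrm{ii}_{03},\mathrm{ii}_{44}\}$. The maximally $\mathfrak I^+$-incomplete subsets of $\mathfrak I^+$ are exactly $\{=_i,\mathrm{ii}_{14}\}$, $\{=_i,\mathrm{ii}_{24},\mathrm{ii}_{04},\mathrm{ii}_{44}\}$, $\{=_i,\mathrm{ii}_{03}\}$. 3. The minimally $\mathfrak M^+$-complete subsets of $\mathfrak M^+$ are exactly $\{\mathrm{ip}_0,\mathrm{ip}_3\}$, $\{\mathrm{ip}_1,\mathrm{ip}_2\}$, $\{\mathrm{ip}_1,\mathrm{ip}_3\}$, $\{\mathrm{ip}_1,\mathrm{ip}_4\}$, $\{\mathrm{ip}_2,\mathrm{ip}_3\}$. The maximally $\mathfrak M^+$-incomplete subsets of $\mathfrak M^+$ are exactly $\{\mathrm{ip}_0,\mathrm{ip}_1\}$, $\{\mathrm{ip}_0,\mathrm{ip}_2,\mathrm{ip}_4\}$, $\{\mathrm{ip}_3,\mathrm{ip}_4\}$. -/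

import Mathlib

universe u

namespace PointInterval

/-- A (strict) interval `[a, b]` of a linear order: an ordered pair of points with `a < b`. -/
structure Intvl (D : Type u) [LinearOrder D] where
  left : D
  right : D
  left_lt_right : left < right

/-- Point-point relation symbols, up to inverse: equality and "less than". -/
inductive PRel
  | eqP | lt
  deriving DecidableEq

/-- Interval-point relation symbols; the index is the region of the order, relative to the
interval, in which the point lies. -/
inductive MRel
  | ip0 | ip1 | ip2 | ip3 | ip4
  deriving DecidableEq

/-- Interval-interval relation symbols (Allen's relations), up to inverse: equality, meets, starts,
finishes, overlaps, during, before. -/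
inductive IRel
  | eqI | ii34 | ii14 | ii03 | ii24 | ii04 | ii44
  deriving DecidableEq

/-- All 14 relation symbols: point-point, mixed (interval-point) and interval-interval. -/
inductive Rel
  | pp (r : PRel)
  | ip (r : MRel)
  | ii (r : IRel)
  deriving DecidableEq

namespace Rel

abbrev eqP : Rel := pp .eqP
abbrev lt : Rel := pp .lt
abbrev ip0 : Rel := ip .ip0
abbrev ip1 : Rel := ip .ip1
abbrev ip2 : Rel := ip .ip2
abbrev ip3 : Rel := ip .ip3
abbrev ip4 : Rel := ip .ip4
abbrev eqI : Rel := ii .eqI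
abbrev ii34 : Rel := ii .ii34
abbrev ii14 : Rel := ii .ii14
abbrev ii03 : Rel := ii .ii03
abbrev ii24 : Rel := ii .ii24
abbrev ii04 : Rel := ii .ii04
abbrev ii44 : Rel := ii .ii44

end Rel

section Semantics

variable {D : Type u} [LinearOrder D]

/-- Interpretation of the point-point relations. -/
def PRel.Holds : PRel → D → D → Prop
  | .eqP, a, b => a = b
  | .lt, a, b => a < b

/-- Interpretation of the interval-point relations: `r.Holds I c` says that `c` lies before `I`,
is its left endpoint, is strictly inside, is its right endpoint, lies after `I`, respectively. -/
def MRel.Holds : MRel → Intvl D → D → Prop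
  | .ip0, I, c => c < I.left
  | .ip1, I, c => c = I.left
  | .ip2, I, c => I.left < c ∧ c < I.right
  | .ip3, I, c => c = I.right
  | .ip4, I, c => I.right < c

/-- Interpretation of the interval-interval relations: for `ii k k'`, the left endpoint of `J` lies
in region `k`, and its right endpoint in region `k'`, of the partition of the order induced by
`I` (0: before `I`, 1: its left endpoint, 2: inside, 3: its right endpoint, 4: after `I`). -/
def IRel.Holds : IRel → Intvl D → Intvl D → Prop
  | .eqI, I, J => I = J
  | .ii34, I, J => I.right = J.left
  | .ii14, I, J => I.left = J.left ∧ I.right < J.right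
  | .ii03, I, J => J.left < I.left ∧ I.right = J.right
  | .ii24, I, J => I.left < J.left ∧ J.left < I.right ∧ I.right < J.right
  | .ii04, I, J => J.left < I.left ∧ I.right < J.right
  | .ii44, I, J => I.right < J.left

end Semantics

/-- Formulas of the two-sorted first-order language without built-in equality over the signature
`S`, with free variables among `n` point variables and `m` interval variables. Quantifiers bind
the variable `0` of their sort and shift the other ones. -/
inductive Formula (S : Finset Rel) : ℕ → ℕ → Type
  | pp {n m : ℕ} (r : PRel) (h : Rel.pp r ∈ S) (x y : Fin n) : Formula S n m
  | ip {n m : ℕ} (r : MRel) (h : Rel.ip r ∈ S) (x : Fin m) (y : Fin n) : Formula S n m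
  | ii {n m : ℕ} (r : IRel) (h : Rel.ii r ∈ S) (x y : Fin m) : Formula S n m
  | falsum {n m : ℕ} : Formula S n m
  | imp {n m : ℕ} (φ ψ : Formula S n m) : Formula S n m
  | allP {n m : ℕ} (φ : Formula S (n + 1) m) : Formula S n m
  | allI {n m : ℕ} (φ : Formula S n (m + 1)) : Formula S n m

/-- Truth of a formula in the concrete point-interval structure over the linear order `D`, under
the assignment `v` of the point variables and `w` of the interval variables. -/
def Formula.Realize {S : Finset Rel} {D : Type u} [LinearOrder D] :
    {n m : ℕ} → Formula S n m → (Fin n → D) → (Fin m → Intvl D) → Prop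
  | _, _, .pp r _ x y, v, _ => r.Holds (v x) (v y)
  | _, _, .ip r _ x y, v, w => r.Holds (w x) (v y)
  | _, _, .ii r _ x y, _, w => r.Holds (w x) (w y)
  | _, _, .falsum, _, _ => False
  | _, _, .imp φ ψ, v, w => φ.Realize v w → ψ.Realize v w
  | _, _, .allP φ, v, w => ∀ a : D, φ.Realize (Fin.cons a v) w
  | _, _, .allI φ, v, w => ∀ I : Intvl D, φ.Realize v (Fin.cons I w)

/-- A class of linear orders. -/
abbrev OrderClass : Type (u + 1) := ∀ (D : Type u) [LinearOrder D], Prop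

/-- The class of all linear orders. -/
def Lin : OrderClass.{u} := fun _ _ => True

/-- The class of all weakly discrete linear orders: every point other than the least one, if there
is one, has a direct predecessor, and every point other than the greatest one, if there is one, has
a direct successor. -/
def Dis : OrderClass.{u} := fun D _ =>
  (∀ a : D, ¬ IsBot a → ∃ b : D, b < a ∧ ∀ c : D, c < a → c ≤ b) ∧
  (∀ a : D, ¬ IsTop a → ∃ b : D, a < b ∧ ∀ c : D, a < c → b ≤ c)

/-- `FO + S` defines the relation `r` over the class `C`: one and the same `FO + S`-formula
`φ(x, y)`, in two free variables of the sorts of `r`, is equivalent to `r(x, y)` in every concrete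
point-interval structure over an order of the class `C`. -/
def Defines (C : OrderClass.{u}) (S : Finset Rel) : Rel → Prop
  | .pp r => ∃ φ : Formula S 2 0, ∀ (D : Type u) [LinearOrder D], C D →
      ∀ a b : D, φ.Realize ![a, b] ![] ↔ r.Holds a b
  | .ip r => ∃ φ : Formula S 1 1, ∀ (D : Type u) [LinearOrder D], C D →
      ∀ (I : Intvl D) (a : D), φ.Realize ![a] ![I] ↔ r.Holds I a
  | .ii r => ∃ φ : Formula S 0 2, ∀ (D : Type u) [LinearOrder D], C D →
      ∀ I J : Intvl D, φ.Realize ![] ![I, J] ↔ r.Holds I J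

/-- `S` is `T`-complete over `C`: `FO + S` defines every relation of `T`. -/
def Complete (C : OrderClass.{u}) (S T : Finset Rel) : Prop :=
  ∀ r ∈ T, Defines C S r

/-- `S` is `T`-incomplete over `C`: `FO + S` fails to define some relation of `T`. -/
def Incomplete (C : OrderClass.{u}) (S T : Finset Rel) : Prop :=
  ∃ r ∈ T, ¬ Defines C S r

/-- `S` is minimally `T`-complete over `C`. -/
def MinimallyComplete (C : OrderClass.{u}) (S T : Finset Rel) : Prop :=
  Complete C S T ∧ ∀ S' : Finset Rel, S' ⊂ S → Incomplete C S' T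

/-- `S` is maximally `T`-incomplete over `C`; the proper supersets of `S` range over the
sub-language `T`. -/
def MaximallyIncomplete (C : OrderClass.{u}) (S T : Finset Rel) : Prop :=
  Incomplete C S T ∧ ∀ S' : Finset Rel, S ⊂ S' → S' ⊆ T → Complete C S' T

/-- All 14 relations (up to inverse). -/
def RPlus : Finset Rel :=
  {.eqP, .lt, .ip0, .ip1, .ip2, .ip3, .ip4, .eqI, .ii34, .ii14, .ii03, .ii24, .ii04, .ii44}

/-- The interval-interval relations (up to inverse), with equality of intervals. -/
def IPlus : Finset Rel := {.eqI, .ii34, .ii14, .ii03, .ii24, .ii04, .ii44}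

/-- The interval-point relations. -/
def MPlus : Finset Rel := {.ip0, .ip1, .ip2, .ip3, .ip4}

/-- The listed minimally complete sets for `RPlus`. -/
def mcsR : Finset (Finset Rel) :=
  { {.ip0, .ip2, .lt},
    {.ip0, .ip3},
    {.ip0, .ip4, .lt},
    {.ip0, .ii14, .ii24, .lt},
    {.ip0, .ii14, .ii04, .lt},
    {.ip0, .ii14, .ii44, .lt},
    {.ip0, .ii03, .lt},
    {.ip0, .ii34, .lt},
    {.ip1, .ip2},
    {.ip1, .ip3},
    {.ip1, .ip4},
    {.ip1, .ii14, .ii24},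
    {.ip1, .ii14, .ii04},
    {.ip1, .ii14, .ii44},
    {.ip1, .ii03},
    {.ip1, .ii34},
    {.ip2, .ip3},
    {.ip2, .ip4, .lt},
    {.ip2, .ii14, .lt},
    {.ip2, .ii03, .lt},
    {.ip2, .ii34, .lt},
    {.ip3, .ii14},
    {.ip3, .ii24, .ii03},
    {.ip3, .ii03, .ii04},
    {.ip3, .ii03, .ii44},
    {.ip3, .ii34},
    {.ip4, .ii14, .lt},
    {.ip4, .ii24, .ii03, .lt},
    {.ip4, .ii03, .ii04, .lt},
    {.ip4, .ii03, .ii44, .lt},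
    {.ip4, .ii34, .lt} }

/-- The listed maximally incomplete sets for `RPlus`. -/
def misR : Finset (Finset Rel) :=
  { {.eqI, .eqP, .lt, .ip0, .ip1, .ii14},
    {.eqI, .eqP, .lt, .ip0, .ip1, .ii24, .ii04, .ii44},
    {.eqP, .ip0, .ip2, .ip4} ∪ IPlus,
    {.eqI, .eqP, .lt, .ip2, .ii24, .ii04, .ii44},
    {.eqP, .lt} ∪ IPlus,
    {.eqI, .eqP, .lt, .ip3, .ip4, .ii03},
    {.eqI, .eqP, .lt, .ip3, .ip4, .ii24, .ii04, .ii44} }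

/-- The listed minimally complete sets for `IPlus`. -/
def mcsI : Finset (Finset Rel) :=
  { {.ii34},
    {.ii14, .ii24},
    {.ii14, .ii04},
    {.ii14, .ii03},
    {.ii14, .ii44},
    {.ii03, .ii24},
    {.ii03, .ii04},
    {.ii03, .ii44} }

/-- The listed maximally incomplete sets for `IPlus`. -/
def misI : Finset (Finset Rel) :=
  { {.eqI, .ii14},
    {.eqI, .ii24, .ii04, .ii44},
    {.eqI, .ii03} }

/-- The listed minimally complete sets for `MPlus`. -/
def mcsM : Finset (Finset Rel) :=
  { {.ip0, .ip3},
    {.ip1, .ip2},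
    {.ip1, .ip3},
    {.ip1, .ip4},
    {.ip2, .ip3} }

/-- The listed maximally incomplete sets for `MPlus`. -/
def misM : Finset (Finset Rel) :=
  { {.ip0, .ip1},
    {.ip0, .ip2, .ip4},
    {.ip3, .ip4} }

end PointInterval

/-!
Let `cl S` be the set of relations definable from `S`. As definability is transitive
(`Defines.trans`), `cl` is a closure operator, and so completeness is monotone in `S`. Therefore it
suffices that the sets listed as minimally complete are complete, that the sets listed as maximally
incomplete are incomplete, that both lists are antichains, and that every set of relations includes
a set from the first list or is included in a set from the second one
(`minimallyComplete_and_maximallyIncomplete`). The last two points are finite combinatorics.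
A formula that works over all linear orders works over the weakly discrete ones, so completeness is
shown over all linear orders, and incompleteness over the weakly discrete ones.

For completeness, everything is definable from `ip1` and `ip3`, which give access to the endpoints
of an interval (`Lin.defines_of_ip1_ip3`), and every interval-interval relation is definable from
`ii34` (`Lin.defines_of_ii34`). So each listed set needs definitions of `ip1` and `ip3`, or of
`ii34`. They come from a handful of rules: for instance, `ip0` and `<` define the left endpoint as
the least point that is not before the interval, and `ii14` together with a comparison of right
endpoints defines `ii34` (`Lin.defines_ii34_of_right_lt`). The delicate cases are those of
endpoints that are the least or the greatest point, where the natural witnesses do not exist.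
Reversing the order exchanges `ip0` with `ip4`, `ip1` with `ip3`, and `ii14` with `ii03`, which
yields the mirror images of the rules (`Defines.dual`).

For incompleteness, a pair of permutations, of the points and of the intervals of one structure,
that preserves the relations in `S` preserves all relations definable from `S`
(`Defines.preserves`). Suitable permutations exist over two or three points, where most relations
are empty, over `ℤ`, where the intervals can be shifted independently of the points, and over
`ℤ ×ₗ ℤ`, where the right endpoints of the intervals reaching over to another copy of `ℤ` can be
shifted independently of the left ones.
-/

namespace PointInterval

universe v

/-! ### Formulas: derived connectives, renaming, substitution -/

attribute [ext] Intvl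

namespace Formula

variable {S : Finset Rel} {n m : ℕ}

/-- Negation. -/
def neg (φ : Formula S n m) : Formula S n m := φ.imp falsum

/-- Conjunction. -/
def and (φ ψ : Formula S n m) : Formula S n m := (φ.imp ψ.neg).neg

/-- Disjunction. -/
def or (φ ψ : Formula S n m) : Formula S n m := φ.neg.imp ψ

/-- Existential quantification over points. -/
def exP (φ : Formula S (n + 1) m) : Formula S n m := φ.neg.allP.neg

/-- Existential quantification over intervals. -/
def exI (φ : Formula S n (m + 1)) : Formula S n m := φ.neg.allI.neg

section Realize

variable {D : Type u} [LinearOrder D] (v : Fin n → D) (w : Fin m → Intvl D)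

@[simp] theorem realize_pp (r : PRel) (h : Rel.pp r ∈ S) (x y : Fin n) :
    (pp r h x y : Formula S n m).Realize v w ↔ r.Holds (v x) (v y) := Iff.rfl

@[simp] theorem realize_ip (r : MRel) (h : Rel.ip r ∈ S) (x : Fin m) (y : Fin n) :
    (ip r h x y : Formula S n m).Realize v w ↔ r.Holds (w x) (v y) := Iff.rfl

@[simp] theorem realize_ii (r : IRel) (h : Rel.ii r ∈ S) (x y : Fin m) :
    (ii r h x y : Formula S n m).Realize v w ↔ r.Holds (w x) (w y) := Iff.rfl

@[simp] theorem realize_imp (φ ψ : Formula S n m) :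
    (φ.imp ψ).Realize v w ↔ (φ.Realize v w → ψ.Realize v w) := Iff.rfl

@[simp] theorem realize_allP (φ : Formula S (n + 1) m) :
    φ.allP.Realize v w ↔ ∀ a : D, φ.Realize (Matrix.vecCons a v) w := Iff.rfl

@[simp] theorem realize_allI (φ : Formula S n (m + 1)) :
    φ.allI.Realize v w ↔ ∀ I : Intvl D, φ.Realize v (Matrix.vecCons I w) := Iff.rfl

@[simp] theorem realize_neg (φ : Formula S n m) :
    φ.neg.Realize v w ↔ ¬ φ.Realize v w := Iff.rfl

@[simp] theorem realize_and (φ ψ : Formula S n m) :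
    (φ.and ψ).Realize v w ↔ φ.Realize v w ∧ ψ.Realize v w := by
  simp [Formula.and]

@[simp] theorem realize_or (φ ψ : Formula S n m) :
    (φ.or ψ).Realize v w ↔ φ.Realize v w ∨ ψ.Realize v w := by
  simp [Formula.or, or_iff_not_imp_left]

@[simp] theorem realize_exP (φ : Formula S (n + 1) m) :
    φ.exP.Realize v w ↔ ∃ a : D, φ.Realize (Matrix.vecCons a v) w := by
  simp [exP]

@[simp] theorem realize_exI (φ : Formula S n (m + 1)) :
    φ.exI.Realize v w ↔ ∃ I : Intvl D, φ.Realize v (Matrix.vecCons I w) := by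
  simp [exI]

end Realize

/-- Renaming of the free variables along `f` (points) and `g` (intervals). -/
def rename {n m n' m' : ℕ} : Formula S n m → (Fin n → Fin n') → (Fin m → Fin m') →
    Formula S n' m'
  | pp r h x y, f, _ => pp r h (f x) (f y)
  | ip r h x y, f, g => ip r h (g x) (f y)
  | ii r h x y, _, g => ii r h (g x) (g y)
  | falsum, _, _ => falsum
  | imp φ ψ, f, g => imp (φ.rename f g) (ψ.rename f g)
  | allP φ, f, g => allP (φ.rename (Fin.cons 0 (Fin.succ ∘ f)) g)
  | allI φ, f, g => allI (φ.rename f (Fin.cons 0 (Fin.succ ∘ g)))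

theorem realize_rename {D : Type u} [LinearOrder D] (φ : Formula S n m) {n' m' : ℕ}
    (f : Fin n → Fin n') (g : Fin m → Fin m') (v : Fin n' → D) (w : Fin m' → Intvl D) :
    (φ.rename f g).Realize v w ↔ φ.Realize (v ∘ f) (w ∘ g) := by
  induction φ generalizing n' m' with
  | pp | ip | ii | falsum => exact Iff.rfl
  | imp φ ψ ih₁ ih₂ => exact imp_congr (ih₁ ..) (ih₂ ..)
  | allP φ ih =>
    refine forall_congr' fun a => (ih ..).trans (Eq.to_iff ?_)
    congr 1
    funext i
    cases i using Fin.cases <;> simp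
  | allI φ ih =>
    refine forall_congr' fun a => (ih ..).trans (Eq.to_iff ?_)
    congr 1
    funext i
    cases i using Fin.cases <;> simp

/-- Application of a formula with two free interval variables to variables `x`, `y`. -/
def app (φ : Formula S 0 2) {n m : ℕ} (x y : Fin m) : Formula S n m :=
  φ.rename ![] ![x, y]

theorem realize_app (φ : Formula S 0 2) {n m : ℕ} (x y : Fin m)
    {D : Type u} [LinearOrder D] (v : Fin n → D) (w : Fin m → Intvl D) :
    (φ.app x y).Realize v w ↔ φ.Realize ![] ![w x, w y] := by
  rw [app, realize_rename]
  congr! 1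
  funext i; fin_cases i <;> rfl

/-- The formula saying that `x` can be prolonged to the right, that is, that its right endpoint is
not the greatest point. -/
def ext (h₁ : .ii14 ∈ S) {n m : ℕ} (x : Fin m) : Formula S n m :=
  exI (ii .ii14 h₁ x.succ 0)

theorem realize_ext (h₁ : .ii14 ∈ S) {n m : ℕ} (x : Fin m)
    {D : Type u} [LinearOrder D] (v : Fin n → D) (w : Fin m → Intvl D) :
    (ext h₁ x : Formula S n m).Realize v w ↔ ∃ c, (w x).right < c := by
  simp only [ext, realize_exI, realize_ii, IRel.Holds, Matrix.cons_val_zero,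
    Matrix.cons_val_succ]
  exact ⟨fun ⟨I, h⟩ => ⟨_, h.2⟩, fun ⟨c, h⟩ => ⟨⟨_, c, (w x).left_lt_right.trans h⟩, rfl, h⟩⟩

end Formula

theorem Defines.of_mem {C : OrderClass.{u}} {S : Finset Rel} {r : Rel} (h : r ∈ S) :
    Defines C S r := by
  cases r with
  | pp r => exact ⟨.pp r h 0 1, fun D _ _ a b => Iff.rfl⟩
  | ip r => exact ⟨.ip r h 0 0, fun D _ _ a b => Iff.rfl⟩
  | ii r => exact ⟨.ii r h 0 1, fun D _ _ a b => Iff.rfl⟩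

/-- Relations of `S'` that are definable from `S` can be eliminated from formulas. -/
theorem Formula.exists_equiv {C : OrderClass.{u}} {S S' : Finset Rel}
    (h : ∀ s ∈ S', Defines C S s) {n m : ℕ} (φ : Formula S' n m) :
    ∃ ψ : Formula S n m, ∀ (D : Type u) [LinearOrder D], C D →
      ∀ (v : Fin n → D) (w : Fin m → Intvl D), ψ.Realize v w ↔ φ.Realize v w := by
  induction φ with
  | pp r hr x y =>
    obtain ⟨ψ, hψ⟩ := h _ hr
    refine ⟨ψ.rename ![x, y] ![], fun D _ hD v w => ?_⟩
    rw [realize_rename, realize_pp, ← hψ D hD]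
    congr! 1
    funext i; fin_cases i <;> rfl
  | ip r hr x y =>
    obtain ⟨ψ, hψ⟩ := h _ hr
    refine ⟨ψ.rename ![y] ![x], fun D _ hD v w => ?_⟩
    rw [realize_rename, realize_ip, ← hψ D hD]
    congr! 1 <;> (funext i; fin_cases i; rfl)
  | ii r hr x y =>
    obtain ⟨ψ, hψ⟩ := h _ hr
    refine ⟨ψ.rename ![] ![x, y], fun D _ hD v w => ?_⟩
    rw [realize_rename, realize_ii, ← hψ D hD]
    congr! 1
    funext i; fin_cases i <;> rfl
  | falsum => exact ⟨.falsum, fun _ _ _ _ _ => Iff.rfl⟩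
  | imp φ φ' ih ih' =>
    obtain ⟨ψ, hψ⟩ := ih
    obtain ⟨ψ', hψ'⟩ := ih'
    exact ⟨ψ.imp ψ', fun D _ hD v w => imp_congr (hψ D hD v w) (hψ' D hD v w)⟩
  | allP φ ih =>
    obtain ⟨ψ, hψ⟩ := ih
    exact ⟨ψ.allP, fun D _ hD v w => forall_congr' fun a => hψ D hD _ w⟩
  | allI φ ih =>
    obtain ⟨ψ, hψ⟩ := ih
    exact ⟨ψ.allI, fun D _ hD v w => forall_congr' fun a => hψ D hD v _⟩

/-- Definability is transitive. -/
theorem Defines.trans {C : OrderClass.{u}} {S S' : Finset Rel} {r : Rel}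
    (hr : Defines C S' r) (h : ∀ s ∈ S', Defines C S s) : Defines C S r := by
  cases r with
  | pp r =>
    obtain ⟨φ, hφ⟩ := hr
    obtain ⟨ψ, hψ⟩ := φ.exists_equiv h
    exact ⟨ψ, fun D _ hD a b => (hψ D hD _ _).trans (hφ D hD a b)⟩
  | ip r =>
    obtain ⟨φ, hφ⟩ := hr
    obtain ⟨ψ, hψ⟩ := φ.exists_equiv h
    exact ⟨ψ, fun D _ hD a b => (hψ D hD _ _).trans (hφ D hD a b)⟩
  | ii r =>
    obtain ⟨φ, hφ⟩ := hr
    obtain ⟨ψ, hψ⟩ := φ.exists_equiv h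
    exact ⟨ψ, fun D _ hD a b => (hψ D hD _ _).trans (hφ D hD a b)⟩

theorem Defines.mono {C : OrderClass.{u}} {S S' : Finset Rel} {r : Rel}
    (h : Defines C S r) (hS : S ⊆ S') : Defines C S' r :=
  h.trans fun _ hs => .of_mem (hS hs)

theorem Defines.anti {C C' : OrderClass.{u}} {S : Finset Rel} {r : Rel}
    (h : Defines C S r) (hC : ∀ (D : Type u) [LinearOrder D], C' D → C D) : Defines C' S r := by
  cases r with
  | pp r => obtain ⟨φ, hφ⟩ := h; exact ⟨φ, fun D _ hD => hφ D (hC D hD)⟩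
  | ip r => obtain ⟨φ, hφ⟩ := h; exact ⟨φ, fun D _ hD => hφ D (hC D hD)⟩
  | ii r => obtain ⟨φ, hφ⟩ := h; exact ⟨φ, fun D _ hD => hφ D (hC D hD)⟩

/-! ### Isomorphism invariance -/

/-- The pair of maps `σ` (on points) and `τ` (on intervals) preserves and reflects the relation
`r`. -/
def Preserves {D : Type u} {E : Type v} [LinearOrder D] [LinearOrder E] (σ : D → E)
    (τ : Intvl D → Intvl E) : Rel → Prop
  | .pp r => ∀ a b, r.Holds (σ a) (σ b) ↔ r.Holds a b
  | .ip r => ∀ I a, r.Holds (τ I) (σ a) ↔ r.Holds I a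
  | .ii r => ∀ I J, r.Holds (τ I) (τ J) ↔ r.Holds I J

/-- An isomorphism of the `S`-reducts of two point-interval structures preserves the truth of all
`S`-formulas. -/
theorem Formula.realize_equiv {D : Type u} {E : Type v} [LinearOrder D] [LinearOrder E]
    (σ : D ≃ E) (τ : Intvl D ≃ Intvl E) {S : Finset Rel} (h : ∀ r ∈ S, Preserves σ τ r)
    {n m : ℕ} (φ : Formula S n m) (v : Fin n → D) (w : Fin m → Intvl D) :
    φ.Realize (σ ∘ v) (τ ∘ w) ↔ φ.Realize v w := by
  induction φ with
  | pp r hr x y => exact h _ hr _ _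
  | ip r hr x y => exact h _ hr _ _
  | ii r hr x y => exact h _ hr _ _
  | falsum => exact Iff.rfl
  | imp φ ψ ih₁ ih₂ => exact imp_congr (ih₁ ..) (ih₂ ..)
  | allP φ ih =>
    refine (σ.forall_congr fun a => ?_).symm
    rw [← ih, Fin.comp_cons]
  | allI φ ih =>
    refine (τ.forall_congr fun a => ?_).symm
    rw [← ih, Fin.comp_cons]

/-- The map on intervals induced by an order isomorphism. -/
def Intvl.congr {D : Type u} {E : Type v} [LinearOrder D] [LinearOrder E] (e : D ≃o E) :
    Intvl D ≃ Intvl E where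
  toFun I := ⟨e I.left, e I.right, e.strictMono I.left_lt_right⟩
  invFun I := ⟨e.symm I.left, e.symm I.right, e.symm.strictMono I.left_lt_right⟩
  left_inv I := by ext <;> simp
  right_inv I := by ext <;> simp

theorem preserves_congr {D : Type u} {E : Type v} [LinearOrder D] [LinearOrder E] (e : D ≃o E)
    (r : Rel) : Preserves e (Intvl.congr e) r := by
  rcases r with r | r | r <;> cases r <;> intro x y <;>
    simp [PRel.Holds, MRel.Holds, IRel.Holds, Intvl.congr, Intvl.ext_iff]

/-- If `S` defines `r`, then every symmetry of the `S`-reduct of a point-interval structure of the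
class preserves `r`. The structure may live in any universe, as long as an isomorphic copy of it
belongs to the class. -/
theorem Defines.preserves {C : OrderClass.{u}} {S : Finset Rel} {r : Rel} (hr : Defines C S r)
    {D : Type v} [LinearOrder D] {E : Type u} [LinearOrder E] (hE : C E) (e : D ≃o E)
    (σ : D ≃ D) (τ : Intvl D ≃ Intvl D) (h : ∀ s ∈ S, Preserves σ τ s) : Preserves σ τ r := by
  have key {n m : ℕ} (φ : Formula S n m) (v : Fin n → D) (w : Fin m → Intvl D) :
      φ.Realize (e ∘ σ ∘ v) (Intvl.congr e ∘ τ ∘ w) ↔ φ.Realize (e ∘ v) (Intvl.congr e ∘ w) := by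
    have := fun v w => φ.realize_equiv e.toEquiv (Intvl.congr e)
      (fun s _ => preserves_congr e s) v w
    exact (this _ _).trans <| (φ.realize_equiv σ τ h v w).trans (this _ _).symm
  have he := preserves_congr e r
  cases r with
  | pp r =>
    obtain ⟨φ, hφ⟩ := hr
    intro a b
    rw [← he, ← he, ← hφ E hE, ← hφ E hE]
    convert key φ ![a, b] ![] using 2 <;>
      (funext i; fin_cases i <;> rfl)
  | ip r =>
    obtain ⟨φ, hφ⟩ := hr
    intro a b
    rw [← he, ← he, ← hφ E hE, ← hφ E hE]
    convert key φ ![b] ![a] using 2 <;> (funext i; fin_cases i; rfl)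
  | ii r =>
    obtain ⟨φ, hφ⟩ := hr
    intro a b
    rw [← he, ← he, ← hφ E hE, ← hφ E hE]
    convert key φ ![] ![a, b] using 2 <;>
      (funext i; fin_cases i <;> rfl)

/-! ### Duality -/

/-- The symbol for the relation obtained by reversing the order, up to exchanging the two
arguments. -/
def Rel.dual : Rel → Rel
  | .pp r => .pp r
  | .ip .ip0 => .ip4
  | .ip .ip1 => .ip3
  | .ip .ip2 => .ip2
  | .ip .ip3 => .ip1
  | .ip .ip4 => .ip0
  | .ii .ii14 => .ii03
  | .ii .ii03 => .ii14
  | .ii r => .ii r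

@[simp] theorem Rel.dual_dual (r : Rel) : r.dual.dual = r := by
  rcases r with r | r | r <;> cases r <;> rfl

/-- An interval, read in the reversed order. -/
def Intvl.dual {D : Type u} [LinearOrder D] : Intvl D ≃ Intvl Dᵒᵈ where
  toFun I := ⟨.toDual I.right, .toDual I.left, I.left_lt_right⟩
  invFun I := ⟨I.right.ofDual, I.left.ofDual, I.left_lt_right⟩
  left_inv _ := rfl
  right_inv _ := rfl

/-- Every formula can be evaluated in the reversed order by a formula over the dual signature. -/
theorem Formula.exists_dual {S : Finset Rel} {n m : ℕ} (φ : Formula S n m) :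
    ∃ ψ : Formula (S.image Rel.dual) n m, ∀ (D : Type u) [LinearOrder D] (v : Fin n → D)
      (w : Fin m → Intvl D),
      ψ.Realize v w ↔ φ.Realize (OrderDual.toDual ∘ v) (Intvl.dual ∘ w) := by
  induction φ with
  | pp r hr x y =>
    have h := Finset.mem_image_of_mem Rel.dual hr
    cases r with
    | eqP => exact ⟨.pp .eqP h x y, fun D _ v w => Iff.rfl⟩
    | lt => exact ⟨.pp .lt h y x, fun D _ v w => Iff.rfl⟩
  | ip r hr x y =>
    have h := Finset.mem_image_of_mem Rel.dual hr
    cases r with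
    | ip2 => exact ⟨.ip _ h x y, fun D _ v w => and_comm⟩
    | _ => exact ⟨.ip _ h x y, fun D _ v w => Iff.rfl⟩
  | ii r hr x y =>
    have h := Finset.mem_image_of_mem Rel.dual hr
    cases r with
    | eqI => exact ⟨.ii _ h x y, fun D _ v w => Intvl.dual.injective.eq_iff.symm⟩
    | ii34 => exact ⟨.ii _ h y x, fun D _ v w => eq_comm⟩
    | ii14 | ii03 | ii04 => exact ⟨.ii _ h x y, fun D _ v w => and_comm⟩
    | ii24 =>
      exact ⟨.ii _ h y x, fun D _ v w =>
        ⟨fun h => ⟨h.2.2, h.2.1, h.1⟩, fun h => ⟨h.2.2, h.2.1, h.1⟩⟩⟩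
    | ii44 => exact ⟨.ii _ h y x, fun D _ v w => Iff.rfl⟩
  | falsum => exact ⟨.falsum, fun _ _ _ _ => Iff.rfl⟩
  | imp φ φ' ih ih' =>
    obtain ⟨ψ, hψ⟩ := ih
    obtain ⟨ψ', hψ'⟩ := ih'
    exact ⟨ψ.imp ψ', fun D _ v w => imp_congr (hψ D v w) (hψ' D v w)⟩
  | allP φ ih =>
    obtain ⟨ψ, hψ⟩ := ih
    refine ⟨ψ.allP, fun D _ v w => OrderDual.toDual.forall_congr fun a => ?_⟩
    rw [hψ, Fin.comp_cons]
  | allI φ ih =>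
    obtain ⟨ψ, hψ⟩ := ih
    refine ⟨ψ.allI, fun D _ v w => Intvl.dual.forall_congr fun a => ?_⟩
    rw [hψ, Fin.comp_cons]

/-- Definability over a class of orders closed under reversal is invariant under duality. -/
theorem Defines.dual {C : OrderClass.{u}} (hC : ∀ (D : Type u) [LinearOrder D], C D → C Dᵒᵈ)
    {S : Finset Rel} {r : Rel} (h : Defines C S r) : Defines C (S.image Rel.dual) r.dual := by
  have swap {ψ : Formula (S.image Rel.dual) 0 2} {D : Type u} [LinearOrder D] {I J : Intvl D} :
      (ψ.rename ![] ![1, 0]).Realize ![] ![I, J] ↔ ψ.Realize ![] ![J, I] := by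
    rw [Formula.realize_rename]
    congr! 1
    funext i; fin_cases i <;> rfl
  have comp₂ {α β : Type u} (f : α → β) (a b : α) : f ∘ ![a, b] = ![f a, f b] := by
    funext i; fin_cases i <;> rfl
  have comp₁ {α β : Type u} (f : α → β) (a : α) : f ∘ ![a] = ![f a] := by
    funext i; fin_cases i; rfl
  have comp₀ {α β : Type u} (f : α → β) : f ∘ ![] = ![] := by
    funext i; exact i.elim0
  cases r with
  | pp r =>
    obtain ⟨φ, hφ⟩ := h
    obtain ⟨ψ, hψ⟩ := φ.exists_dual
    cases r with
    | eqP =>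
      refine ⟨ψ, fun D _ hD a b => ?_⟩
      rw [hψ, comp₂, comp₀, hφ _ (hC D hD)]
      exact Iff.rfl
    | lt =>
      refine ⟨ψ.rename ![1, 0] ![], fun D _ hD a b => ?_⟩
      have hba : (![a, b] : Fin 2 → D) ∘ ![1, 0] = ![b, a] := by
        funext i; fin_cases i <;> rfl
      rw [Formula.realize_rename, hba, hψ, comp₂, Matrix.empty_eq (Intvl.dual ∘ _),
        hφ _ (hC D hD)]
      exact Iff.rfl
  | ip r =>
    obtain ⟨φ, hφ⟩ := h
    obtain ⟨ψ, hψ⟩ := φ.exists_dual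
    have key (D : Type u) [LinearOrder D] (hD : C D) (I : Intvl D) (a : D) :
        ψ.Realize ![a] ![I] ↔ r.Holds I.dual (OrderDual.toDual a) := by
      rw [hψ, comp₁, comp₁, hφ _ (hC D hD)]
    cases r with
    | ip2 => exact ⟨ψ, fun D _ hD I a => (key D hD I a).trans and_comm⟩
    | _ => exact ⟨ψ, fun D _ hD I a => key D hD I a⟩
  | ii r =>
    obtain ⟨φ, hφ⟩ := h
    obtain ⟨ψ, hψ⟩ := φ.exists_dual
    have key (D : Type u) [LinearOrder D] (hD : C D) (I J : Intvl D) :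
        ψ.Realize ![] ![I, J] ↔ r.Holds I.dual J.dual := by
      rw [hψ, comp₀, comp₂, hφ _ (hC D hD)]
    cases r with
    | eqI => exact ⟨ψ, fun D _ hD I J => (key D hD I J).trans Intvl.dual.injective.eq_iff⟩
    | ii34 => exact ⟨_, fun D _ hD I J => swap.trans <| (key D hD J I).trans eq_comm⟩
    | ii14 | ii03 | ii04 => exact ⟨ψ, fun D _ hD I J => (key D hD I J).trans and_comm⟩
    | ii24 =>
      exact ⟨_, fun D _ hD I J => swap.trans <| (key D hD J I).trans
        ⟨fun h => ⟨h.2.2, h.2.1, h.1⟩, fun h => ⟨h.2.2, h.2.1, h.1⟩⟩⟩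
    | ii44 => exact ⟨_, fun D _ hD I J => swap.trans (key D hD J I)⟩

theorem Lin.dual (D : Type u) [LinearOrder D] (_ : Lin D) : Lin Dᵒᵈ := trivial

theorem Dis.dual (D : Type u) [LinearOrder D] (h : Dis D) : Dis Dᵒᵈ :=
  ⟨fun a ha => h.2 a fun h => ha h, fun a ha => h.1 a fun h => ha h⟩

/-- The dual of a definability rule is obtained by dualizing its premises, applying the rule to
the dual signature, and undoing the dualization of the conclusion with this lemma. -/
theorem Defines.of_dual {C : OrderClass.{u}}
    (hC : ∀ (D : Type u) [LinearOrder D], C D → C Dᵒᵈ) {S : Finset Rel} {r : Rel}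
    (h : Defines C (S.image Rel.dual) r.dual) : Defines C S r := by
  simpa [Finset.image_image, Function.comp_def] using h.dual hC

/-! ### Rules with point-interval relations -/

namespace Lin

variable {S : Finset Rel}

open Formula

theorem defines_ip1_of_ip0_lt (h₀ : Defines Lin.{u} S .ip0) (hlt : Defines Lin.{u} S .lt) :
    Defines Lin.{u} S .ip1 := by
  refine Defines.trans (S' := {.ip0, .lt}) ?_ (by simp [h₀, hlt])
  -- the left endpoint is the least point not before the interval
  refine ⟨and (neg (ip .ip0 (by decide) 0 0))
    (allP (imp (pp .lt (by decide) 0 1) (ip .ip0 (by decide) 0 0))), fun D _ _ I a => ?_⟩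
  simp [PRel.Holds, MRel.Holds]
  constructor
  · rintro ⟨h, h'⟩
    by_contra hne
    exact lt_irrefl _ (h' I.left (lt_of_le_of_ne h (Ne.symm hne)))
  · rintro rfl
    exact ⟨le_rfl, fun _ => id⟩

theorem defines_ip3_of_ip1_ip2 (h₁ : Defines Lin.{u} S .ip1) (h₂ : Defines Lin.{u} S .ip2) :
    Defines Lin.{u} S .ip3 := by
  have hlt : Defines Lin.{u} S .lt := by
    refine Defines.trans (S' := {.ip1, .ip2}) ?_ (by simp [h₁, h₂])
    -- `b` lies inside an interval starting at `a`, unless `b` is the greatest point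
    refine ⟨exI (and (ip .ip1 (by decide) 0 0)
      (or (ip .ip2 (by decide) 0 1) (allI (neg (ip .ip1 (by decide) 0 1))))), fun D _ _ a b => ?_⟩
    simp [PRel.Holds, MRel.Holds]
    constructor
    · rintro ⟨I, rfl, h | h⟩
      · exact h.1
      · by_contra! h'
        exact h ⟨b, _, h'.trans_lt I.left_lt_right⟩ rfl
    · intro h
      by_cases h' : ∃ c, b < c
      · obtain ⟨c, hc⟩ := h'
        exact ⟨⟨a, c, h.trans hc⟩, rfl, .inl ⟨h, hc⟩⟩
      · exact ⟨⟨a, b, h⟩, rfl, .inr fun J hJ => h' ⟨_, hJ ▸ J.left_lt_right⟩⟩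
  refine Defines.trans (S' := {.ip1, .ip2, .lt}) ?_ (by simp [h₁, h₂, hlt])
  -- the right endpoint is the least point that is after the left endpoint and not inside
  refine ⟨exP (and (ip .ip1 (by decide) 0 0) (and (pp .lt (by decide) 0 1)
    (and (neg (ip .ip2 (by decide) 0 1)) (allP (imp (pp .lt (by decide) 1 0)
      (imp (pp .lt (by decide) 0 2) (ip .ip2 (by decide) 0 0))))))), fun D _ _ I a => ?_⟩
  simp [PRel.Holds, MRel.Holds]
  constructor
  · rintro ⟨h₁, h₂, h₃⟩
    by_contra hne
    exact lt_irrefl _ (h₃ _ I.left_lt_right (lt_of_le_of_ne (h₂ h₁) (Ne.symm hne))).2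
  · rintro rfl
    exact ⟨I.left_lt_right, fun _ => le_rfl, fun _ h h' => ⟨h, h'⟩⟩

theorem defines_lt_of_ip1_ip4 (h₁ : Defines Lin.{u} S .ip1) (h₄ : Defines Lin.{u} S .ip4) :
    Defines Lin.{u} S .lt := by
  refine Defines.trans (S' := {.ip1, .ip4}) ?_ (by simp [h₁, h₄])
  -- `a ≠ b`, and there is `I` starting at `a` such that every point after some interval starting at
  -- `b` lies after `I`: for `a < b` take `I = [a, b]`; if `b < a`, the right endpoint of `I` lies
  -- after `[b, a]`, but not after `I`
  refine ⟨and (neg (or (exI (and (ip .ip1 (by decide) 0 0) (ip .ip1 (by decide) 0 1)))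
      (allI (and (neg (ip .ip1 (by decide) 0 0)) (neg (ip .ip1 (by decide) 0 1))))))
    (exI (and (ip .ip1 (by decide) 0 0) (allI (imp (ip .ip1 (by decide) 0 1)
      (allP (imp (ip .ip4 (by decide) 0 0) (ip .ip4 (by decide) 1 0))))))), fun D _ _ a b => ?_⟩
  simp [PRel.Holds, MRel.Holds]
  constructor
  · rintro ⟨⟨h, -⟩, I, rfl, hI⟩
    by_contra! hb
    obtain hb | rfl := hb.lt_or_eq
    · exact lt_irrefl _ (hI ⟨b, I.left, hb⟩ rfl _ I.left_lt_right)
    · exact h I rfl rfl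
  · intro h
    refine ⟨⟨?_, ⟨a, b, h⟩, by simp⟩, ⟨a, b, h⟩, rfl, ?_⟩
    · rintro I rfl
      exact h.ne'
    · rintro I rfl c hc
      exact I.left_lt_right.trans hc

theorem defines_ip3_of_ip1_ii34 (h₁ : Defines Lin.{u} S .ip1) (h : Defines Lin.{u} S .ii34) :
    Defines Lin.{u} S .ip3 := by
  refine Defines.trans (S' := {.ip1, .ii34}) ?_ (by simp [h₁, h])
  -- the second disjunct is for an interval whose right endpoint is the greatest point
  refine ⟨or (exI (and (ii .ii34 (by decide) 1 0) (ip .ip1 (by decide) 0 0)))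
    (and (allI (neg (ii .ii34 (by decide) 1 0))) (allI (neg (ip .ip1 (by decide) 0 0)))),
    fun D _ _ I a => ?_⟩
  simp [IRel.Holds, MRel.Holds]
  constructor
  · rintro (⟨J, h, rfl⟩ | ⟨h, h'⟩)
    · exact h.symm
    · by_contra hne
      obtain hlt | hlt := lt_or_gt_of_ne hne
      · exact h' ⟨_, _, hlt⟩ rfl
      · exact h ⟨_, _, hlt⟩ rfl
  · rintro rfl
    by_cases h : ∃ c, I.right < c
    · obtain ⟨c, hc⟩ := h
      exact .inl ⟨⟨_, c, hc⟩, rfl, rfl⟩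
    · exact .inr ⟨fun J hJ => h ⟨_, hJ ▸ J.left_lt_right⟩, fun J hJ => h ⟨_, hJ ▸ J.left_lt_right⟩⟩

theorem defines_ip2_of_ip1_ii03 (h₁ : Defines Lin.{u} S .ip1) (h : Defines Lin.{u} S .ii03) :
    Defines Lin.{u} S .ip2 := by
  refine Defines.trans (S' := {.ip1, .ii03}) ?_ (by simp [h₁, h])
  refine ⟨exI (and (ii .ii03 (by decide) 0 1) (ip .ip1 (by decide) 0 0)), fun D _ _ I a => ?_⟩
  simp [IRel.Holds, MRel.Holds]
  constructor
  · rintro ⟨J, ⟨h, h'⟩, rfl⟩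
    exact ⟨h, h' ▸ J.left_lt_right⟩
  · rintro ⟨h, h'⟩
    exact ⟨⟨a, _, h'⟩, ⟨h, rfl⟩, rfl⟩

theorem defines_ip1_of_ip2_ii14_lt (h₂ : Defines Lin.{u} S .ip2) (h : Defines Lin.{u} S .ii14)
    (hlt : Defines Lin.{u} S .lt) : Defines Lin.{u} S .ip1 := by
  refine Defines.trans (S' := {.ip2, .ii14, .lt}) ?_ (by simp [h₂, h, hlt])
  -- `φ x`: there are points inside the interval `x`, and the free point variable stands for the
  -- greatest point before all of them
  let φ {m : ℕ} (x : Fin m) : Formula {.ip2, .ii14, .lt} 1 m :=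
    and (exP (ip .ip2 (by decide) x 0)) (and
      (allP (imp (ip .ip2 (by decide) x 0) (pp .lt (by decide) 1 0)))
      (allP (imp (pp .lt (by decide) 1 0)
        (exP (and (ip .ip2 (by decide) x 0) (neg (pp .lt (by decide) 1 0)))))))
  have hφ {D : Type u} [LinearOrder D] {m : ℕ} (x : Fin m) (a : D) (w : Fin m → Intvl D) :
      (φ x).Realize ![a] w ↔ (∃ c, (w x).left < c ∧ c < (w x).right) ∧ a = (w x).left := by
    simp only [φ, PRel.Holds, MRel.Holds, realize_and, realize_exP, realize_allP, realize_ip,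
      realize_imp, realize_pp, realize_neg, Matrix.cons_val, not_lt]
    refine and_congr_right fun ⟨c, hc, hc'⟩ => ⟨fun ⟨h₁, h₂⟩ => ?_, ?_⟩
    · obtain h | h | h := lt_trichotomy a (w x).left
      · obtain ⟨d, ⟨hd, -⟩, hd'⟩ := h₂ _ h
        exact absurd hd hd'.not_gt
      · exact h
      · exact absurd (h₁ a ⟨h, (h₁ c ⟨hc, hc'⟩).trans hc'⟩) (lt_irrefl a)
    · rintro rfl
      refine ⟨fun _ h => h.1, fun f hf => ?_⟩
      obtain h | h := lt_or_ge f (w x).right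
      · exact ⟨f, ⟨hf, h⟩, le_rfl⟩
      · exact ⟨c, ⟨hc, hc'⟩, hc'.le.trans h⟩
  -- an interval without inner points can be prolonged, or has the greatest point as its right
  -- endpoint and the predecessor of that point as its left one
  refine ⟨or (φ 0) (or (exI (and (ii .ii14 (by decide) 1 0) (φ 0)))
    (and (allP (neg (ip .ip2 (by decide) 0 0))) (and (allI (neg (ii .ii14 (by decide) 1 0)))
    (exP (and (pp .lt (by decide) 1 0) (allP (and (neg (pp .lt (by decide) 1 0))
      (neg (and (pp .lt (by decide) 2 0) (pp .lt (by decide) 0 1)))))))))), fun D _ _ I a => ?_⟩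
  simp [hφ, PRel.Holds, MRel.Holds, IRel.Holds]
  constructor
  · rintro (h | ⟨J, ⟨h, -⟩, -, h'⟩ | ⟨h₁, h₂, l, hl, hl'⟩)
    · exact h.2
    · rw [h', h]
    · have hI : I.right = l := by
        by_contra hne
        obtain hlt | hlt := lt_or_gt_of_ne hne
        · exact absurd ((h₂ ⟨I.left, l, I.left_lt_right.trans hlt⟩ rfl)) (by simpa using hlt)
        · exact absurd (hl' I.right).1 (by simpa using hlt)
      subst hI
      obtain h | h | h := lt_trichotomy a I.left
      · exact absurd I.left_lt_right ((hl' _).2 h).not_gt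
      · exact h
      · exact absurd hl (h₁ a h).not_gt
  · rintro rfl
    by_cases h : ∃ c, I.left < c ∧ c < I.right
    · exact .inl ⟨h, rfl⟩
    by_cases h' : ∃ c, I.right < c
    · obtain ⟨c, hc⟩ := h'
      exact .inr <| .inl ⟨⟨I.left, c, I.left_lt_right.trans hc⟩, ⟨rfl, hc⟩,
        ⟨_, I.left_lt_right, hc⟩, rfl⟩
    · push Not at h h'
      exact .inr <| .inr ⟨h, fun J _ => h' _, I.right, I.left_lt_right, fun c => ⟨h' c, h c⟩⟩

/-- Once both endpoints of an interval are definable, so is everything else: the relations are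
conditions on the order of the endpoints. -/
theorem defines_of_ip1_ip3 (h₁ : Defines Lin.{u} S .ip1) (h₃ : Defines Lin.{u} S .ip3) (r : Rel) :
    Defines Lin.{u} S r := by
  have hlt : Defines Lin.{u} S .lt := by
    refine Defines.trans (S' := {.ip1, .ip3}) ?_ (by simp [h₁, h₃])
    refine ⟨exI (and (ip .ip1 (by decide) 0 0) (ip .ip3 (by decide) 0 1)), fun D _ _ a b => ?_⟩
    simp [PRel.Holds, MRel.Holds]
    constructor
    · rintro ⟨I, rfl, rfl⟩
      exact I.left_lt_right
    · exact fun h => ⟨⟨a, b, h⟩, rfl, rfl⟩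
  have heq : Defines Lin.{u} S .eqP := by
    refine Defines.trans (S' := {.lt}) ?_ (by simp [hlt])
    refine ⟨and (neg (pp .lt (by decide) 0 1)) (neg (pp .lt (by decide) 1 0)), fun D _ _ a b => ?_⟩
    simp [PRel.Holds]
    exact le_antisymm_iff.symm.trans eq_comm
  refine Defines.trans (S' := {.ip1, .ip3, .lt, .eqP}) ?_ (by simp [h₁, h₃, hlt, heq])
  let lt' {n m : ℕ} (x y : Fin n) : Formula {.ip1, .ip3, .lt, .eqP} n m := pp .lt (by decide) x y
  let eq' {n m : ℕ} (x y : Fin n) : Formula {.ip1, .ip3, .lt, .eqP} n m := pp .eqP (by decide) x y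
  -- the point variables `3, 2, 1, 0` of `ψ` stand for the endpoints of `I` and of `J`
  have endpoints (ψ : Formula {.ip1, .ip3, .lt, .eqP} 4 2) :
      ∃ φ : Formula {.ip1, .ip3, .lt, .eqP} 0 2,
      ∀ {D : Type u} [LinearOrder D] (I J : Intvl D), φ.Realize ![] ![I, J] ↔
        ψ.Realize ![J.right, J.left, I.right, I.left] ![I, J] := by
    refine ⟨exP (exP (exP (exP (and (ip .ip1 (by decide) 0 3) (and (ip .ip3 (by decide) 0 2)
      (and (ip .ip1 (by decide) 1 1) (and (ip .ip3 (by decide) 1 0) ψ))))))), fun I J => ?_⟩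
    simp [MRel.Holds]
  have ofEndpoints {r : IRel} (ψ : Formula {.ip1, .ip3, .lt, .eqP} 4 2)
      (hψ : ∀ (D : Type u) [LinearOrder D] (I J : Intvl D),
        ψ.Realize ![J.right, J.left, I.right, I.left] ![I, J] ↔ r.Holds I J) :
      Defines Lin.{u} {.ip1, .ip3, .lt, .eqP} (.ii r) := by
    obtain ⟨φ, hφ⟩ := endpoints ψ
    exact ⟨φ, fun D _ _ I J => (hφ I J).trans (hψ D I J)⟩
  rcases r with r | r | r
  · cases r <;> exact .of_mem (by decide)
  · cases r with
    | ip1 | ip3 => exact .of_mem (by decide)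
    | ip0 =>
      refine ⟨exP (and (ip .ip1 (by decide) 0 0) (lt' 1 0)), fun D _ _ I a => ?_⟩
      simp [lt', MRel.Holds, PRel.Holds]
    | ip2 =>
      refine ⟨exP (exP (and (ip .ip1 (by decide) 0 1) (and (ip .ip3 (by decide) 0 0)
        (and (lt' 1 2) (lt' 2 0))))), fun D _ _ I a => ?_⟩
      simp [lt', MRel.Holds, PRel.Holds]
    | ip4 =>
      refine ⟨exP (and (ip .ip3 (by decide) 0 0) (lt' 0 1)), fun D _ _ I a => ?_⟩
      simp [lt', MRel.Holds, PRel.Holds]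
  · cases r with
    | eqI =>
      refine ofEndpoints (and (eq' 3 1) (eq' 2 0)) fun D _ I J => ?_
      simp [eq', IRel.Holds, PRel.Holds, Intvl.ext_iff]
    | ii34 =>
      refine ofEndpoints (eq' 2 1) fun D _ I J => ?_
      simp [eq', IRel.Holds, PRel.Holds]
    | ii14 =>
      refine ofEndpoints (and (eq' 3 1) (lt' 2 0)) fun D _ I J => ?_
      simp [eq', lt', IRel.Holds, PRel.Holds]
    | ii03 =>
      refine ofEndpoints (and (lt' 1 3) (eq' 2 0)) fun D _ I J => ?_
      simp [eq', lt', IRel.Holds, PRel.Holds]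
    | ii24 =>
      refine ofEndpoints (and (lt' 3 1) (and (lt' 1 2) (lt' 2 0))) fun D _ I J => ?_
      simp [lt', IRel.Holds, PRel.Holds]
    | ii04 =>
      refine ofEndpoints (and (lt' 1 3) (lt' 2 0)) fun D _ I J => ?_
      simp [lt', IRel.Holds, PRel.Holds]
    | ii44 =>
      refine ofEndpoints (lt' 2 1) fun D _ I J => ?_
      simp [lt', IRel.Holds, PRel.Holds]

/-! ### Rules with interval-interval relations -/

/-- An interval shares its left endpoint with another one iff they are met by the same intervals,
also when one of the endpoints is the least point; dually for right endpoints. Hence the endpoints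
can be compared using witnesses for the strict inequalities. -/
theorem defines_of_ii34 (h : Defines Lin.{u} S .ii34) (r : IRel) : Defines Lin.{u} S (.ii r) := by
  refine Defines.trans (S' := {.ii34}) ?_ (by simp [h])
  let mt {m : ℕ} (x y : Fin m) : Formula {.ii34} 0 m := ii .ii34 (by decide) x y
  -- the intervals `x` and `y` have the same left endpoint, the same right endpoint
  let sl {m : ℕ} (x y : Fin m) : Formula {.ii34} 0 m :=
    allI (and (imp (mt 0 x.succ) (mt 0 y.succ)) (imp (mt 0 y.succ) (mt 0 x.succ)))
  let sr {m : ℕ} (x y : Fin m) : Formula {.ii34} 0 m :=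
    allI (and (imp (mt x.succ 0) (mt y.succ 0)) (imp (mt y.succ 0) (mt x.succ 0)))
  -- comparisons of the left endpoints, of the right endpoints, of a left and a right endpoint
  let ll {m : ℕ} (x y : Fin m) : Formula {.ii34} 0 m := exI (and (sl 0 x.succ) (mt 0 y.succ))
  let rr {m : ℕ} (x y : Fin m) : Formula {.ii34} 0 m := exI (and (mt x.succ 0) (sr 0 y.succ))
  let lr {m : ℕ} (x y : Fin m) : Formula {.ii34} 0 m := exI (and (sl 0 x.succ) (sr 0 y.succ))
  have hsl {D : Type u} [LinearOrder D] {m : ℕ} (x y : Fin m) (w : Fin m → Intvl D) :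
      (sl x y).Realize ![] w ↔ (w x).left = (w y).left := by
    simp only [sl, mt, realize_allI, realize_and, realize_imp, realize_ii, IRel.Holds,
      Matrix.cons_val_zero, Matrix.cons_val_succ, ← iff_def]
    refine ⟨fun h => ?_, fun h I => by rw [h]⟩
    by_contra hne
    obtain hlt | hlt := lt_or_gt_of_ne hne
    · exact hne ((h ⟨_, _, hlt⟩).2 rfl).symm
    · exact hne ((h ⟨_, _, hlt⟩).1 rfl)
  have hsr {D : Type u} [LinearOrder D] {m : ℕ} (x y : Fin m) (w : Fin m → Intvl D) :
      (sr x y).Realize ![] w ↔ (w x).right = (w y).right := by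
    simp only [sr, mt, realize_allI, realize_and, realize_imp, realize_ii, IRel.Holds,
      Matrix.cons_val_zero, Matrix.cons_val_succ, ← iff_def]
    refine ⟨fun h => ?_, fun h I => by rw [h]⟩
    by_contra hne
    obtain hlt | hlt := lt_or_gt_of_ne hne
    · exact hne ((h ⟨_, _, hlt⟩).1 rfl).symm
    · exact hne ((h ⟨_, _, hlt⟩).2 rfl)
  have hll {D : Type u} [LinearOrder D] {m : ℕ} (x y : Fin m) (w : Fin m → Intvl D) :
      (ll x y).Realize ![] w ↔ (w x).left < (w y).left := by
    simp only [ll, mt, hsl, realize_exI, realize_and, realize_ii, IRel.Holds,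
      Matrix.cons_val_zero, Matrix.cons_val_succ]
    exact ⟨fun ⟨I, h, h'⟩ => h ▸ h' ▸ I.left_lt_right, fun h => ⟨⟨_, _, h⟩, rfl, rfl⟩⟩
  have hrr {D : Type u} [LinearOrder D] {m : ℕ} (x y : Fin m) (w : Fin m → Intvl D) :
      (rr x y).Realize ![] w ↔ (w x).right < (w y).right := by
    simp only [rr, mt, hsr, realize_exI, realize_and, realize_ii, IRel.Holds,
      Matrix.cons_val_zero, Matrix.cons_val_succ]
    exact ⟨fun ⟨I, h, h'⟩ => h ▸ h' ▸ I.left_lt_right, fun h => ⟨⟨_, _, h⟩, rfl, rfl⟩⟩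
  have hlr {D : Type u} [LinearOrder D] {m : ℕ} (x y : Fin m) (w : Fin m → Intvl D) :
      (lr x y).Realize ![] w ↔ (w x).left < (w y).right := by
    simp only [lr, hsl, hsr, realize_exI, realize_and,
      Matrix.cons_val_zero, Matrix.cons_val_succ]
    exact ⟨fun ⟨I, h, h'⟩ => h ▸ h' ▸ I.left_lt_right, fun h => ⟨⟨_, _, h⟩, rfl, rfl⟩⟩
  cases r with
  | eqI =>
    refine ⟨and (sl 0 1) (sr 0 1), fun D _ _ I J => ?_⟩
    simp [hsl, hsr, IRel.Holds, Intvl.ext_iff]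
  | ii34 => exact .of_mem (by decide)
  | ii14 =>
    refine ⟨and (sl 0 1) (rr 0 1), fun D _ _ I J => ?_⟩
    simp [hsl, hrr, IRel.Holds]
  | ii03 =>
    refine ⟨and (ll 1 0) (sr 0 1), fun D _ _ I J => ?_⟩
    simp [hsr, hll, IRel.Holds]
  | ii24 =>
    refine ⟨and (ll 0 1) (and (lr 1 0) (rr 0 1)), fun D _ _ I J => ?_⟩
    simp [hll, hlr, hrr, IRel.Holds]
  | ii04 =>
    refine ⟨and (ll 1 0) (rr 0 1), fun D _ _ I J => ?_⟩
    simp [hll, hrr, IRel.Holds]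
  | ii44 =>
    refine ⟨exI (and (mt 1 0) (mt 0 2)), fun D _ _ I J => ?_⟩
    simp [mt, IRel.Holds]
    exact ⟨fun ⟨I, h, h'⟩ => h ▸ h' ▸ I.left_lt_right, fun h => ⟨⟨_, _, h⟩, rfl, rfl⟩⟩

/-- Two adjacent intervals `I`, `J` are an initial and a final part of a third one, `K`; they do
not overlap, and `I` is the longest initial part of `K` that does not overlap with `J`. -/
theorem defines_ii34_of_ii14_ii03 (h₁ : Defines Lin.{u} S .ii14) (h₃ : Defines Lin.{u} S .ii03) :
    Defines Lin.{u} S .ii34 := by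
  refine Defines.trans (S' := {.ii14, .ii03}) ?_ (by simp [h₁, h₃])
  -- for an initial part `x` and a final part `y` of an interval, `ov x y` says that they overlap
  let ov {m : ℕ} (x y : Fin m) : Formula {.ii14, .ii03} 0 m :=
    exI (and (ii .ii03 (by decide) 0 x.succ) (ii .ii14 (by decide) 0 y.succ))
  have hov {D : Type u} [LinearOrder D] {m : ℕ} (x y : Fin m) (w : Fin m → Intvl D) :
      (ov x y).Realize ![] w ↔ (w x).left < (w y).left ∧ (w y).left < (w x).right ∧
        (w x).right < (w y).right := by
    simp only [ov, realize_exI, realize_and, realize_ii, IRel.Holds, Matrix.cons_val_zero,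
      Matrix.cons_val_succ]
    constructor
    · rintro ⟨I, ⟨h₁, h₂⟩, h₃, h₄⟩
      have := I.left_lt_right
      rw [h₃] at h₁ this
      rw [h₂] at h₄ this
      exact ⟨h₁, this, h₄⟩
    · rintro ⟨h₁, h₂, h₃⟩
      exact ⟨⟨_, _, h₂⟩, ⟨h₁, rfl⟩, rfl, h₃⟩
  refine ⟨exI (and (ii .ii14 (by decide) 1 0) (and (ii .ii03 (by decide) 2 0) (and (neg (ov 1 2))
    (neg (exI (and (ii .ii14 (by decide) 2 0) (and (ii .ii14 (by decide) 0 1)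
      (neg (ov 0 3))))))))), fun D _ _ I J => ?_⟩
  simp [hov, IRel.Holds]
  constructor
  · rintro ⟨K, ⟨h₁, h₂⟩, ⟨h₃, h₄⟩, h₅, h₆⟩
    by_contra hne
    obtain hlt | hlt := lt_or_gt_of_ne hne
    · obtain ⟨-, h, -⟩ := h₆ ⟨I.left, J.left, I.left_lt_right.trans hlt⟩ rfl hlt h₁
        (J.left_lt_right.trans_eq h₄)
      exact lt_irrefl _ h
    · exact (h₅ (h₁ ▸ h₃) hlt).not_gt (h₂.trans_eq h₄.symm)
  · intro h
    have hJ := J.left_lt_right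
    have hI := I.left_lt_right
    refine ⟨⟨I.left, J.right, hI.trans (h ▸ hJ)⟩, ⟨rfl, h.trans_lt hJ⟩, ⟨hI.trans_eq h, rfl⟩,
      fun _ h' => absurd h h'.ne', ?_⟩
    intro K hK hIK _ hKJ
    exact ⟨hK ▸ h ▸ hI, h ▸ hIK, hKJ⟩

/-- With `ii14` available, it suffices to be able to compare right endpoints. -/
theorem defines_ii34_of_right_lt (h₁ : .ii14 ∈ S) (φ : Formula S 0 2)
    (hφ : ∀ (D : Type u) [LinearOrder D] (I J : Intvl D),
      φ.Realize ![] ![I, J] ↔ I.right < J.right) : Defines Lin.{u} S .ii34 := by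
  -- the right endpoint of `x` is at most the left endpoint of `y` iff it precedes the right
  -- endpoint of every interval that starts together with `y` and is not longer than `y`
  let rl {m : ℕ} (x y : Fin m) : Formula S 0 m := and (φ.app x y)
    (allI (imp (ii .ii14 h₁ 0 y.succ) (φ.app x.succ 0)))
  have hrl {D : Type u} [LinearOrder D] {m : ℕ} (x y : Fin m) (w : Fin m → Intvl D) :
      (rl x y).Realize ![] w ↔ (w x).right ≤ (w y).left := by
    simp only [rl, realize_app, realize_and, realize_allI, realize_imp, realize_ii, IRel.Holds,
      hφ, Matrix.cons_val_zero, Matrix.cons_val_succ]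
    constructor
    · rintro ⟨h, h'⟩
      by_contra! hlt
      exact lt_irrefl _ (h' ⟨_, _, hlt⟩ ⟨rfl, h⟩)
    · intro h
      exact ⟨h.trans_lt (w y).left_lt_right, fun I hI => h.trans_lt (hI.1 ▸ I.left_lt_right)⟩
  refine ⟨and (rl 0 1) (neg (exI (and (ii .ii14 h₁ 1 0) (rl 0 2)))), fun D _ _ I J => ?_⟩
  simp [hrl, IRel.Holds]
  constructor
  · rintro ⟨h, h'⟩
    by_contra hne
    have hlt := lt_of_le_of_ne h hne
    exact lt_irrefl _ (h' ⟨I.left, J.left, I.left_lt_right.trans hlt⟩ rfl hlt)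
  · intro h
    exact ⟨h.le, fun K _ hK => h ▸ hK⟩

theorem defines_ii34_of_ii14_ii44 (h₁ : Defines Lin.{u} S .ii14) (h₄ : Defines Lin.{u} S .ii44) :
    Defines Lin.{u} S .ii34 := by
  refine Defines.trans (S' := {.ii14, .ii44}) ?_ (by simp [h₁, h₄])
  refine defines_ii34_of_right_lt (by decide) (or
    (and (ext (by decide) 0) (neg (ext (by decide) 1)))
    (exI (and (ii .ii44 (by decide) 1 0) (neg (ii .ii44 (by decide) 2 0))))) fun D _ I J => ?_
  simp [realize_ext, IRel.Holds]
  constructor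
  · rintro (⟨⟨c, hc⟩, h⟩ | ⟨K, h, h'⟩)
    · exact hc.trans_le (h c)
    · exact h.trans_le h'
  · intro h
    by_cases hJ : ∃ c, J.right < c
    · obtain ⟨c, hc⟩ := hJ
      exact .inr ⟨⟨_, c, hc⟩, h, le_rfl⟩
    · exact .inl ⟨⟨_, h⟩, by simpa using hJ⟩

theorem defines_ii34_of_ii14_ii04 (h₁ : Defines Lin.{u} S .ii14) (h₄ : Defines Lin.{u} S .ii04) :
    Defines Lin.{u} S .ii34 := by
  refine Defines.trans (S' := {.ii14, .ii04}) ?_ (by simp [h₁, h₄])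
  -- the last disjunct covers the case that `J` starts after `I` and can be prolonged; the interval
  -- `K` that starts together with `I` and ends together with `J` is a witness
  refine defines_ii34_of_right_lt (by decide) (or (or (and (ext (by decide) 0)
    (neg (ext (by decide) 1))) (or (ii .ii14 (by decide) 0 1) (ii .ii04 (by decide) 0 1)))
    (exI (and (ii .ii14 (by decide) 1 0) (and (neg (ii .ii04 (by decide) 2 0))
      (exI (and (ii .ii14 (by decide) 1 0) (ii .ii04 (by decide) 3 0))))))) fun D _ I J => ?_
  simp [realize_ext, IRel.Holds]
  constructor
  · rintro ((⟨⟨c, hc⟩, h⟩ | h | h) | ⟨K, ⟨-, h⟩, h', K', ⟨hK, -⟩, hJ, -⟩)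
    · exact hc.trans_le (h c)
    · exact h.2
    · exact h.2
    · exact h.trans_le (h' (hK ▸ hJ))
  · intro h
    by_cases hJ : ∃ c, J.right < c
    · obtain ⟨c, hc⟩ := hJ
      obtain h' | h' | h' := lt_trichotomy I.left J.left
      · have hK := I.left_lt_right.trans h
        exact .inr ⟨⟨_, _, hK⟩, ⟨rfl, h⟩, fun _ => le_rfl, ⟨_, c, hK.trans hc⟩, ⟨rfl, hc⟩, h', hc⟩
      · exact .inl <| .inr <| .inl ⟨h', h⟩
      · exact .inl <| .inr <| .inr ⟨h', h⟩
    · exact .inl <| .inl ⟨⟨_, h⟩, by simpa using hJ⟩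

theorem defines_ii34_of_ii14_ii24 (h₁ : Defines Lin.{u} S .ii14) (h₂ : Defines Lin.{u} S .ii24) :
    Defines Lin.{u} S .ii34 := by
  refine Defines.trans (S' := {.ii14, .ii24}) ?_ (by simp [h₁, h₂])
  -- the last two disjuncts cover the cases that `J` can be prolonged and starts after `I`, before
  -- `I`; the interval `K` that starts together with `I` and ends together with `J` is a witness
  refine defines_ii34_of_right_lt (by decide) (or (or (and (ext (by decide) 0)
    (neg (ext (by decide) 1))) (ii .ii14 (by decide) 0 1))
    (exI (and (ii .ii14 (by decide) 1 0) (or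
      (and (ext (by decide) 2) (allI (imp (ii .ii14 (by decide) 3 0) (ii .ii24 (by decide) 1 0))))
      (and (neg (ii .ii24 (by decide) 2 0))
        (exI (and (ii .ii14 (by decide) 1 0) (ii .ii24 (by decide) 3 0))))))))
    fun D _ I J => ?_
  simp [realize_ext, IRel.Holds]
  constructor
  · rintro ((⟨⟨c, hc⟩, h⟩ | h) | ⟨K, ⟨-, h⟩, ⟨⟨c, hc⟩, h'⟩ | ⟨h', K', ⟨hK, -⟩, hJ, hJ', -⟩⟩)
    · exact hc.trans_le (h c)
    · exact h.2
    · refine h.trans_le ?_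
      obtain ⟨-, hK, -⟩ := h' ⟨J.left, c, J.left_lt_right.trans hc⟩ rfl hc
      by_contra! hJ
      exact lt_irrefl _ (h' ⟨J.left, K.right, hK⟩ rfl hJ).2.2
    · rw [← hK] at hJ hJ'
      exact h.trans_le (h' hJ hJ')
  · intro h
    by_cases hJ : ∃ c, J.right < c
    · obtain ⟨c, hc⟩ := hJ
      have hK := I.left_lt_right.trans h
      obtain h' | h' | h' := lt_trichotomy I.left J.left
      · refine .inr ⟨⟨_, _, hK⟩, ⟨rfl, h⟩, .inl ⟨⟨c, hc⟩, fun J' hl hr => ?_⟩⟩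
        exact ⟨hl ▸ h', hl ▸ J.left_lt_right, hr⟩
      · exact .inl <| .inr ⟨h', h⟩
      · exact .inr ⟨⟨_, _, hK⟩, ⟨rfl, h⟩, .inr ⟨fun _ _ => le_rfl, ⟨_, c, hK.trans hc⟩, ⟨rfl, hc⟩,
          h', hK, hc⟩⟩
    · exact .inl <| .inl ⟨⟨_, h⟩, by simpa using hJ⟩

/-! ### Complete sets -/

theorem defines_ip3_of_ip4_lt (h₄ : Defines Lin.{u} S .ip4) (hlt : Defines Lin.{u} S .lt) :
    Defines Lin.{u} S .ip3 :=
  .of_dual Lin.dual (defines_ip1_of_ip0_lt (h₄.dual Lin.dual) (hlt.dual Lin.dual))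

theorem defines_ip3_of_ip2_ii03_lt (h₂ : Defines Lin.{u} S .ip2) (h : Defines Lin.{u} S .ii03)
    (hlt : Defines Lin.{u} S .lt) : Defines Lin.{u} S .ip3 :=
  .of_dual Lin.dual
    (defines_ip1_of_ip2_ii14_lt (h₂.dual Lin.dual) (h.dual Lin.dual) (hlt.dual Lin.dual))

theorem defines_of_ip1_ip2 (h₁ : Defines Lin.{u} S .ip1) (h₂ : Defines Lin.{u} S .ip2) (r : Rel) :
    Defines Lin.{u} S r :=
  defines_of_ip1_ip3 h₁ (defines_ip3_of_ip1_ip2 h₁ h₂) r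

theorem defines_of_ip1_ip4 (h₁ : Defines Lin.{u} S .ip1) (h₄ : Defines Lin.{u} S .ip4) (r : Rel) :
    Defines Lin.{u} S r :=
  defines_of_ip1_ip3 h₁ (defines_ip3_of_ip4_lt h₄ (defines_lt_of_ip1_ip4 h₁ h₄)) r

theorem defines_of_ip1_ii34 (h₁ : Defines Lin.{u} S .ip1) (h : Defines Lin.{u} S .ii34)
    (r : Rel) : Defines Lin.{u} S r :=
  defines_of_ip1_ip3 h₁ (defines_ip3_of_ip1_ii34 h₁ h) r

theorem defines_of_ip1_ii03 (h₁ : Defines Lin.{u} S .ip1) (h : Defines Lin.{u} S .ii03)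
    (r : Rel) : Defines Lin.{u} S r :=
  defines_of_ip1_ip2 h₁ (defines_ip2_of_ip1_ii03 h₁ h) r

theorem defines_of_ip2_ip3 (h₂ : Defines Lin.{u} S .ip2) (h₃ : Defines Lin.{u} S .ip3) (r : Rel) :
    Defines Lin.{u} S r :=
  .of_dual Lin.dual (defines_of_ip1_ip2 (h₃.dual Lin.dual) (h₂.dual Lin.dual) _)

theorem defines_of_ip0_ip3 (h₀ : Defines Lin.{u} S .ip0) (h₃ : Defines Lin.{u} S .ip3) (r : Rel) :
    Defines Lin.{u} S r :=
  .of_dual Lin.dual (defines_of_ip1_ip4 (h₃.dual Lin.dual) (h₀.dual Lin.dual) _)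

theorem defines_of_ip3_ii34 (h₃ : Defines Lin.{u} S .ip3) (h : Defines Lin.{u} S .ii34)
    (r : Rel) : Defines Lin.{u} S r :=
  .of_dual Lin.dual (defines_of_ip1_ii34 (h₃.dual Lin.dual) (h.dual Lin.dual) _)

theorem defines_of_ip3_ii14 (h₃ : Defines Lin.{u} S .ip3) (h : Defines Lin.{u} S .ii14)
    (r : Rel) : Defines Lin.{u} S r :=
  .of_dual Lin.dual (defines_of_ip1_ii03 (h₃.dual Lin.dual) (h.dual Lin.dual) _)

theorem defines_ii34_of_ii03_ii24 (h₁ : Defines Lin.{u} S .ii03) (h₂ : Defines Lin.{u} S .ii24) :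
    Defines Lin.{u} S .ii34 :=
  .of_dual Lin.dual (defines_ii34_of_ii14_ii24 (h₁.dual Lin.dual) (h₂.dual Lin.dual))

theorem defines_ii34_of_ii03_ii04 (h₁ : Defines Lin.{u} S .ii03) (h₂ : Defines Lin.{u} S .ii04) :
    Defines Lin.{u} S .ii34 :=
  .of_dual Lin.dual (defines_ii34_of_ii14_ii04 (h₁.dual Lin.dual) (h₂.dual Lin.dual))

theorem defines_ii34_of_ii03_ii44 (h₁ : Defines Lin.{u} S .ii03) (h₂ : Defines Lin.{u} S .ii44) :
    Defines Lin.{u} S .ii34 :=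
  .of_dual Lin.dual (defines_ii34_of_ii14_ii44 (h₁.dual Lin.dual) (h₂.dual Lin.dual))

theorem complete_of_mem_mcsR {A : Finset Rel} (hA : A ∈ mcsR) : Complete Lin.{u} A RPlus := by
  have m {S : Finset Rel} {r : Rel} (h : r ∈ S := by decide) : Defines Lin.{u} S r := .of_mem h
  intro r _
  simp only [mcsR, Finset.mem_insert, Finset.mem_singleton] at hA
  rcases hA with rfl | rfl | rfl | rfl | rfl | rfl | rfl | rfl | rfl | rfl | rfl | rfl | rfl | rfl |
    rfl | rfl | rfl | rfl | rfl | rfl | rfl | rfl | rfl | rfl | rfl | rfl | rfl | rfl | rfl | rfl |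
    rfl
  · exact defines_of_ip1_ip2 (defines_ip1_of_ip0_lt m m) m r
  · exact defines_of_ip0_ip3 m m r
  · exact defines_of_ip1_ip4 (defines_ip1_of_ip0_lt m m) m r
  · exact defines_of_ip1_ii34 (defines_ip1_of_ip0_lt m m) (defines_ii34_of_ii14_ii24 m m) r
  · exact defines_of_ip1_ii34 (defines_ip1_of_ip0_lt m m) (defines_ii34_of_ii14_ii04 m m) r
  · exact defines_of_ip1_ii34 (defines_ip1_of_ip0_lt m m) (defines_ii34_of_ii14_ii44 m m) r
  · exact defines_of_ip1_ii03 (defines_ip1_of_ip0_lt m m) m r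
  · exact defines_of_ip1_ii34 (defines_ip1_of_ip0_lt m m) m r
  · exact defines_of_ip1_ip2 m m r
  · exact defines_of_ip1_ip3 m m r
  · exact defines_of_ip1_ip4 m m r
  · exact defines_of_ip1_ii34 m (defines_ii34_of_ii14_ii24 m m) r
  · exact defines_of_ip1_ii34 m (defines_ii34_of_ii14_ii04 m m) r
  · exact defines_of_ip1_ii34 m (defines_ii34_of_ii14_ii44 m m) r
  · exact defines_of_ip1_ii03 m m r
  · exact defines_of_ip1_ii34 m m r
  · exact defines_of_ip2_ip3 m m r
  · exact defines_of_ip2_ip3 m (defines_ip3_of_ip4_lt m m) r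
  · exact defines_of_ip1_ip2 (defines_ip1_of_ip2_ii14_lt m m m) m r
  · exact defines_of_ip2_ip3 m (defines_ip3_of_ip2_ii03_lt m m m) r
  · exact defines_of_ip1_ip2 (defines_ip1_of_ip2_ii14_lt m (defines_of_ii34 m _) m) m r
  · exact defines_of_ip3_ii14 m m r
  · exact defines_of_ip3_ii34 m (defines_ii34_of_ii03_ii24 m m) r
  · exact defines_of_ip3_ii34 m (defines_ii34_of_ii03_ii04 m m) r
  · exact defines_of_ip3_ii34 m (defines_ii34_of_ii03_ii44 m m) r
  · exact defines_of_ip3_ii34 m m r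
  · exact defines_of_ip3_ii14 (defines_ip3_of_ip4_lt m m) m r
  · exact defines_of_ip3_ii34 (defines_ip3_of_ip4_lt m m) (defines_ii34_of_ii03_ii24 m m) r
  · exact defines_of_ip3_ii34 (defines_ip3_of_ip4_lt m m) (defines_ii34_of_ii03_ii04 m m) r
  · exact defines_of_ip3_ii34 (defines_ip3_of_ip4_lt m m) (defines_ii34_of_ii03_ii44 m m) r
  · exact defines_of_ip3_ii34 (defines_ip3_of_ip4_lt m m) m r

theorem complete_of_mem_mcsI {A : Finset Rel} (hA : A ∈ mcsI) : Complete Lin.{u} A IPlus := by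
  have m {S : Finset Rel} {r : Rel} (h : r ∈ S := by decide) : Defines Lin.{u} S r := .of_mem h
  have h34 : Defines Lin.{u} A .ii34 := by
    simp only [mcsI, Finset.mem_insert, Finset.mem_singleton] at hA
    rcases hA with rfl | rfl | rfl | rfl | rfl | rfl | rfl | rfl
    · exact m
    · exact defines_ii34_of_ii14_ii24 m m
    · exact defines_ii34_of_ii14_ii04 m m
    · exact defines_ii34_of_ii14_ii03 m m
    · exact defines_ii34_of_ii14_ii44 m m
    · exact defines_ii34_of_ii03_ii24 m m
    · exact defines_ii34_of_ii03_ii04 m m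
    · exact defines_ii34_of_ii03_ii44 m m
  intro r hr
  cases r with
  | ii r => exact defines_of_ii34 h34 r
  | pp r => exact absurd hr (by cases r <;> decide)
  | ip r => exact absurd hr (by cases r <;> decide)

theorem complete_of_mem_mcsM {A : Finset Rel} (hA : A ∈ mcsM) : Complete Lin.{u} A MPlus := by
  have h : A ∈ mcsR := (by decide +kernel : mcsM ⊆ mcsR) hA
  exact fun r hr => complete_of_mem_mcsR h r ((by decide : MPlus ⊆ RPlus) hr)

end Lin

/-! ### Incomplete sets -/

namespace Dis

/-- Weak discreteness is transported along an isomorphism, possibly between universes. -/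
theorem congr {D : Type*} {E : Type u} [LinearOrder D] [LinearOrder E] (e : D ≃o E)
    (h₁ : ∀ a : D, ¬ IsBot a → ∃ b : D, b < a ∧ ∀ c : D, c < a → c ≤ b)
    (h₂ : ∀ a : D, ¬ IsTop a → ∃ b : D, a < b ∧ ∀ c : D, a < c → b ≤ c) : Dis E := by
  refine ⟨fun a ha => ?_, fun a ha => ?_⟩
  · obtain ⟨b, hb, h⟩ := h₁ (e.symm a) fun h => ha fun c => by simpa using h (e.symm c)
    exact ⟨e b, by simpa [e.lt_symm_apply] using hb, fun c hc => by
      simpa [e.symm_apply_le] using h (e.symm c) (by simpa using hc)⟩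
  · obtain ⟨b, hb, h⟩ := h₂ (e.symm a) fun h => ha fun c => by simpa using h (e.symm c)
    exact ⟨e b, by simpa [e.symm_apply_lt] using hb, fun c hc => by
      simpa [e.le_symm_apply] using h (e.symm c) (by simpa using hc)⟩

theorem not_defines {D : Type} [LinearOrder D] (hD : Dis D) (σ : D ≃ D) (τ : Intvl D ≃ Intvl D)
    {S : Finset Rel} {r : Rel} (hS : ∀ s ∈ S, Preserves σ τ s) (hr : ¬ Preserves σ τ r) :
    ¬ Defines Dis.{u} S r := fun h =>
  hr <| h.preserves (congr ULift.orderIso.symm hD.1 hD.2) ULift.orderIso.symm σ τ hS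

theorem of_succOrder_predOrder (D : Type u) [LinearOrder D] [SuccOrder D] [PredOrder D] : Dis D :=
  ⟨fun a ha => ⟨Order.pred a, Order.pred_lt_of_not_isMin fun h => ha h.isBot,
      fun _ => Order.le_pred_of_lt⟩,
    fun a ha => ⟨Order.succ a, Order.lt_succ_of_not_isMax fun h => ha h.isTop,
      fun _ => Order.succ_le_of_lt⟩⟩

theorem int_prod_int : Dis (ℤ ×ₗ ℤ) := by
  refine ⟨fun a _ => ⟨toLex ((ofLex a).1, (ofLex a).2 - 1), ?_⟩,
    fun a _ => ⟨toLex ((ofLex a).1, (ofLex a).2 + 1), ?_⟩⟩ <;>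
  · simp only [Prod.Lex.lt_iff, Prod.Lex.le_iff, ofLex_toLex, true_and]
    refine ⟨by omega, fun c => by omega⟩

section Finite

variable {D : Type} [LinearOrder D]

instance : DecidableEq (Intvl D) := fun I J =>
  decidable_of_iff (I.left = J.left ∧ I.right = J.right) Intvl.ext_iff.symm

instance [Fintype D] : Fintype (Intvl D) :=
  Fintype.ofEquiv {p : D × D // p.1 < p.2}
    ⟨fun p => ⟨_, _, p.2⟩, fun I => ⟨(I.left, I.right), I.left_lt_right⟩,
      fun _ => rfl, fun _ => rfl⟩

instance [Fintype D] (σ : D → D) (τ : Intvl D → Intvl D) (r : Rel) :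
    Decidable (Preserves σ τ r) := by
  rcases r with r | r | r <;> cases r <;>
    simp only [Preserves, PRel.Holds, MRel.Holds, IRel.Holds] <;> infer_instance

end Finite

/-- Over `ℤ ×ₗ ℤ`, the right endpoints of the intervals that are not contained in one copy of `ℤ`
can be shifted by one. -/
def shiftRight : Intvl (ℤ ×ₗ ℤ) ≃ Intvl (ℤ ×ₗ ℤ) :=
  have aux (k : ℤ) (I : Intvl (ℤ ×ₗ ℤ)) : I.left < toLex ((ofLex I.right).1,
      if (ofLex I.left).1 < (ofLex I.right).1 then (ofLex I.right).2 + k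
        else (ofLex I.right).2) := by
    have := I.left_lt_right
    simp only [Prod.Lex.lt_iff, ofLex_toLex] at this ⊢
    split_ifs <;> omega
  { toFun I := ⟨_, _, aux 1 I⟩
    invFun I := ⟨_, _, aux (-1) I⟩
    left_inv I := by
      ext
      · rfl
      · apply ofLex.injective
        ext <;> simp
        split_ifs <;> simp
    right_inv I := by
      ext
      · rfl
      · apply ofLex.injective
        ext <;> simp
        split_ifs <;> simp }

theorem preserves_shiftRight :
    ∀ s ∈ ({.eqI, .eqP, .lt, .ip0, .ip1, .ii14} : Finset Rel),
      Preserves (Equiv.refl _) shiftRight s := by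
  simp only [Finset.forall_mem_insert, Finset.mem_singleton, forall_eq]
  refine ⟨fun I J => shiftRight.injective.eq_iff, fun _ _ => Iff.rfl, fun _ _ => Iff.rfl,
    fun _ _ => Iff.rfl, fun _ _ => Iff.rfl, fun I J => and_congr_right fun h => ?_⟩
  have hI := I.left_lt_right
  have hJ := J.left_lt_right
  change I.left = J.left at h
  rw [h] at hI
  simp only [shiftRight, Equiv.coe_fn_mk, h, Prod.Lex.lt_iff, ofLex_toLex] at hI hJ ⊢
  split_ifs <;> omega

theorem not_defines_of_shiftRight {r : Rel} (hr : r = .ii34 ∨ r = .ip3) :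
    ¬ Defines Dis.{u} {.eqI, .eqP, .lt, .ip0, .ip1, .ii14} r := by
  refine not_defines int_prod_int _ _ preserves_shiftRight ?_
  let I : Intvl (ℤ ×ₗ ℤ) := ⟨toLex (0, 0), toLex (1, 0), by simp [Prod.Lex.lt_iff]⟩
  let J : Intvl (ℤ ×ₗ ℤ) := ⟨toLex (1, 0), toLex (1, 1), by simp [Prod.Lex.lt_iff]⟩
  rcases hr with rfl | rfl
  · intro h
    have := (h I J).2 rfl
    simp [IRel.Holds, shiftRight, I, J] at this
  · intro h
    have := (h I I.right).2 rfl
    simp [MRel.Holds, shiftRight, I] at this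

/-- Over three points `0 < 1 < 2`, the relations `ii24`, `ii04` and `ii44` are empty, as they need
four distinct endpoints; so `[0, 1]` and `[0, 2]` can be exchanged. -/
theorem not_defines_of_swap_right {r : Rel} (hr : r = .ii34 ∨ r = .ip3) :
    ¬ Defines Dis.{u} {.eqI, .eqP, .lt, .ip0, .ip1, .ii24, .ii04, .ii44} r := by
  refine not_defines (of_succOrder_predOrder (Fin 3)) (Equiv.refl _)
    (Equiv.swap ⟨0, 1, by decide⟩ ⟨0, 2, by decide⟩) (by decide +kernel) ?_
  rcases hr with rfl | rfl <;> decide +kernel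

/-- Over two points, the relations `ip0`, `ip2` and `ip4` are empty, and there is a single interval;
so the points can be exchanged. -/
theorem not_defines_of_swap_points :
    ¬ Defines Dis.{u} ({.eqP, .ip0, .ip2, .ip4} ∪ IPlus) .ip1 :=
  not_defines (of_succOrder_predOrder (Fin 2)) (Equiv.swap 0 1) (Equiv.refl _)
    (by decide +kernel) (by decide +kernel)

/-- Over three points `0 < 1 < 2`, the intervals `[0, 1]` and `[1, 2]` have no inner points and can
be exchanged. -/
theorem not_defines_of_swap_short :
    ¬ Defines Dis.{u} {.eqI, .eqP, .lt, .ip2, .ii24, .ii04, .ii44} .ip1 :=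
  not_defines (of_succOrder_predOrder (Fin 3)) (Equiv.refl _)
    (Equiv.swap ⟨0, 1, by decide⟩ ⟨1, 2, by decide⟩) (by decide +kernel) (by decide +kernel)

/-- Over `ℤ`, the intervals can be shifted while the points stay fixed. -/
theorem not_defines_of_shift_intervals : ¬ Defines Dis.{u} ({.eqP, .lt} ∪ IPlus) .ip1 := by
  refine not_defines (of_succOrder_predOrder ℤ) (Equiv.refl _)
    (Intvl.congr (OrderIso.addRight 1)) (fun s hs => ?_) fun h => ?_
  · cases s with
    | pp r => exact fun _ _ => Iff.rfl
    | ip r => exact absurd hs (by cases r <;> decide)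
    | ii r => exact preserves_congr (OrderIso.addRight (1 : ℤ)) (.ii r)
  · have := (h ⟨0, 1, one_pos⟩ 0).2 rfl
    simp [MRel.Holds, Intvl.congr] at this

theorem not_defines_of_shiftLeft {r : Rel} (hr : r = .ii34 ∨ r = .ip1) :
    ¬ Defines Dis.{u} {.eqI, .eqP, .lt, .ip3, .ip4, .ii03} r := fun h =>
  not_defines_of_shiftRight (r := r.dual) (by rcases hr with rfl | rfl <;> simp [Rel.dual])
    ((h.dual Dis.dual).mono (by decide))

theorem not_defines_of_swap_left {r : Rel} (hr : r = .ii34 ∨ r = .ip1) :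
    ¬ Defines Dis.{u} {.eqI, .eqP, .lt, .ip3, .ip4, .ii24, .ii04, .ii44} r := fun h =>
  not_defines_of_swap_right (r := r.dual) (by rcases hr with rfl | rfl <;> simp [Rel.dual])
    ((h.dual Dis.dual).mono (by decide))

theorem incomplete_of_mem_misR {B : Finset Rel} (hB : B ∈ misR) : Incomplete Dis.{u} B RPlus := by
  simp only [misR, Finset.mem_insert, Finset.mem_singleton] at hB
  rcases hB with rfl | rfl | rfl | rfl | rfl | rfl | rfl
  · exact ⟨.ii34, by decide, not_defines_of_shiftRight (.inl rfl)⟩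
  · exact ⟨.ii34, by decide, not_defines_of_swap_right (.inl rfl)⟩
  · exact ⟨.ip1, by decide, not_defines_of_swap_points⟩
  · exact ⟨.ip1, by decide, not_defines_of_swap_short⟩
  · exact ⟨.ip1, by decide, not_defines_of_shift_intervals⟩
  · exact ⟨.ii34, by decide, not_defines_of_shiftLeft (.inl rfl)⟩
  · exact ⟨.ii34, by decide, not_defines_of_swap_left (.inl rfl)⟩

theorem incomplete_of_mem_misI {B : Finset Rel} (hB : B ∈ misI) : Incomplete Dis.{u} B IPlus := by
  simp only [misI, Finset.mem_insert, Finset.mem_singleton] at hB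
  refine ⟨.ii34, by decide, fun h => ?_⟩
  rcases hB with rfl | rfl | rfl
  · exact not_defines_of_shiftRight (.inl rfl) (h.mono (by decide))
  · exact not_defines_of_swap_right (.inl rfl) (h.mono (by decide))
  · exact not_defines_of_shiftLeft (.inl rfl) (h.mono (by decide))

theorem incomplete_of_mem_misM {B : Finset Rel} (hB : B ∈ misM) : Incomplete Dis.{u} B MPlus := by
  simp only [misM, Finset.mem_insert, Finset.mem_singleton] at hB
  rcases hB with rfl | rfl | rfl
  · exact ⟨.ip3, by decide, fun h =>
      not_defines_of_shiftRight (.inr rfl) (h.mono (by decide))⟩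
  · exact ⟨.ip1, by decide, fun h => not_defines_of_swap_points (h.mono (by decide))⟩
  · exact ⟨.ip1, by decide, fun h =>
      not_defines_of_shiftLeft (.inr rfl) (h.mono (by decide))⟩

end Dis

/-! ### Minimally complete and maximally incomplete sets -/

/-- The propositional part of the classification: a set of relations that meets the complement of
each member of `misR` includes a member of `mcsR`. -/
theorem subset_or_subset_R {S : Finset Rel} (hS : S ⊆ RPlus) :
    (∃ A ∈ mcsR, A ⊆ S) ∨ ∃ B ∈ misR, S ⊆ B := by
  refine or_iff_not_imp_right.2 fun H => ?_
  replace H : ∀ B ∈ misR, ∃ r ∈ RPlus \ B, r ∈ S := fun B hB => by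
    obtain ⟨r, hr, hrB⟩ := Finset.not_subset.1 fun h => H ⟨B, hB, h⟩
    exact ⟨r, Finset.mem_sdiff.2 ⟨hS hr, hrB⟩, hr⟩
  clear hS
  simp only [misR, Finset.forall_mem_insert, Finset.mem_singleton, forall_eq] at H
  obtain ⟨h₁, h₂, h₃, h₄, h₅, h₆, h₇⟩ := H
  rw [show RPlus \ _ = {.ip2, .ip3, .ip4, .ii34, .ii03, .ii24, .ii04, .ii44}
    by decide +kernel] at h₁
  rw [show RPlus \ _ = {.ip2, .ip3, .ip4, .ii34, .ii14, .ii03} by decide +kernel] at h₂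
  rw [show RPlus \ _ = {.lt, .ip1, .ip3} by decide +kernel] at h₃
  rw [show RPlus \ _ = {.ip0, .ip1, .ip3, .ip4, .ii34, .ii14, .ii03} by decide +kernel] at h₄
  rw [show RPlus \ _ = {.ip0, .ip1, .ip2, .ip3, .ip4} by decide +kernel] at h₅
  rw [show RPlus \ _ = {.ip0, .ip1, .ip2, .ii34, .ii14, .ii24, .ii04, .ii44}
    by decide +kernel] at h₆
  rw [show RPlus \ _ = {.ip0, .ip1, .ip2, .ii34, .ii14, .ii03} by decide +kernel] at h₇
  simp only [Finset.exists_mem_insert, Finset.mem_singleton, exists_eq_left] at h₁ h₂ h₃ h₄ h₅ h₆ h₇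
  simp only [mcsR, Finset.exists_mem_insert, Finset.mem_singleton, exists_eq_left,
    Finset.insert_subset_iff, Finset.singleton_subset_iff]
  grind (splits := 40)

/-- If `mc` consists of complete sets and `mi` of incomplete sets, both are antichains, and every
set includes a member of `mc` or is included in a member of `mi`, then the minimally complete sets
are the members of `mc`, and the maximally incomplete sets are the members of `mi`. -/
theorem minimallyComplete_and_maximallyIncomplete {C : OrderClass.{u}} {T : Finset Rel}
    {mc mi : Finset (Finset Rel)} (hmc : ∀ A ∈ mc, Complete C A T)
    (hmi : ∀ B ∈ mi, Incomplete C B T)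
    (cover : ∀ S ⊆ T, (∃ A ∈ mc, A ⊆ S) ∨ ∃ B ∈ mi, S ⊆ B)
    (antichain_mc : ∀ A ∈ mc, ∀ A' ∈ mc, A ⊆ A' → A = A')
    (antichain_mi : ∀ B ∈ mi, ∀ B' ∈ mi, B ⊆ B' → B = B') (hT : ∀ B ∈ mi, B ⊆ T)
    (S : Finset Rel) (hS : S ⊆ T) :
    (S ∈ mc ↔ MinimallyComplete C S T) ∧ (S ∈ mi ↔ MaximallyIncomplete C S T) := by
  have complete_mono {A S : Finset Rel} (h : A ⊆ S) (hA : Complete C A T) : Complete C S T :=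
    fun r hr => (hA r hr).mono h
  have incomplete_mono {S B : Finset Rel} (h : S ⊆ B) : Incomplete C B T → Incomplete C S T :=
    fun ⟨r, hr, hB⟩ => ⟨r, hr, fun hS => hB (hS.mono h)⟩
  have not_both {S : Finset Rel} (h : Complete C S T) : ¬ Incomplete C S T :=
    fun ⟨r, hr, hn⟩ => hn (h r hr)
  refine ⟨⟨fun h => ⟨hmc S h, fun S' hS' => ?_⟩, fun ⟨h, hmin⟩ => ?_⟩,
    ⟨fun h => ⟨hmi S h, fun S' hS' hT' => ?_⟩, fun ⟨h, hmax⟩ => ?_⟩⟩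
  · obtain ⟨A, hA, hAS⟩ | ⟨B, hB, hSB⟩ := cover S' (hS'.subset.trans hS)
    · exact absurd (antichain_mc A hA S h (hAS.trans hS'.subset)) (hAS.trans_ssubset hS').ne
    · exact incomplete_mono hSB (hmi B hB)
  · obtain ⟨A, hA, hAS⟩ | ⟨B, hB, hSB⟩ := cover S hS
    · obtain rfl | hlt := hAS.eq_or_ssubset
      · exact hA
      · exact absurd (hmin A hlt) (not_both (hmc A hA))
    · exact absurd (incomplete_mono hSB (hmi B hB)) (not_both h)
  · obtain ⟨A, hA, hAS⟩ | ⟨B, hB, hSB⟩ := cover S' hT'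
    · exact complete_mono hAS (hmc A hA)
    · exact absurd (antichain_mi S h B hB (hS'.subset.trans hSB)) (hS'.trans_subset hSB).ne
  · obtain ⟨A, hA, hAS⟩ | ⟨B, hB, hSB⟩ := cover S hS
    · exact absurd h (not_both (complete_mono hAS (hmc A hA)))
    · obtain rfl | hlt := hSB.eq_or_ssubset
      · exact hB
      · exact absurd (hmi B hB) (not_both (hmax B hlt (hT B hB)))

end PointInterval

open PointInterval in
theorem mainTheorem1 (C : OrderClass.{u}) (hC : C = Lin.{u} ∨ C = Dis.{u}) :
    (∀ S : Finset Rel, S ⊆ RPlus →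
      (S ∈ mcsR ↔ MinimallyComplete C S RPlus) ∧
      (S ∈ misR ↔ MaximallyIncomplete C S RPlus)) ∧
    (∀ S : Finset Rel, S ⊆ IPlus →
      (S ∈ mcsI ↔ MinimallyComplete C S IPlus) ∧
      (S ∈ misI ↔ MaximallyIncomplete C S IPlus)) ∧
    (∀ S : Finset Rel, S ⊆ MPlus →
      (S ∈ mcsM ↔ MinimallyComplete C S MPlus) ∧
      (S ∈ misM ↔ MaximallyIncomplete C S MPlus)) := by
  -- `Dis ⊆ C ⊆ Lin`: definability passes from `Lin` to `C`, and from `C` to `Dis`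
  have complete {A T : Finset Rel} (h : Complete Lin.{u} A T) : Complete C A T :=
    fun r hr => (h r hr).anti fun _ _ _ => trivial
  have incomplete {B T : Finset Rel} : Incomplete Dis.{u} B T → Incomplete C B T :=
    fun ⟨r, hr, h⟩ => ⟨r, hr, fun hC' => h <| hC'.anti fun _ _ hD => by
      rcases hC with rfl | rfl
      · trivial
      · exact hD⟩
  refine ⟨minimallyComplete_and_maximallyIncomplete
      (fun _ hA => complete (Lin.complete_of_mem_mcsR hA))
      (fun _ hB => incomplete (Dis.incomplete_of_mem_misR hB))
      (fun _ => subset_or_subset_R) ?_ ?_ ?_,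
    minimallyComplete_and_maximallyIncomplete
      (fun _ hA => complete (Lin.complete_of_mem_mcsI hA))
      (fun _ hB => incomplete (Dis.incomplete_of_mem_misI hB)) ?_ ?_ ?_ ?_,
    minimallyComplete_and_maximallyIncomplete
      (fun _ hA => complete (Lin.complete_of_mem_mcsM hA))
      (fun _ hB => incomplete (Dis.incomplete_of_mem_misM hB)) ?_ ?_ ?_ ?_⟩ <;>
    decide +kernel
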